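/- **Setting.** Let $\Lambda\in\{-1,0,1\}$, let $\mathbb C_\Lambda=\mathbb R[\ell]/(\ell^2+\Lambda)$ with conjugation $\overline{x+\ell y}=x-\ell y$ and $|z|^2=z\bar z$, and write $e^{\ell\theta}=c_\Lambda(\theta)+\ell s_\Lambda(\theta)$, so that $s_\Lambda(\theta)=\sin\theta,\ \theta,\ \sinh\theta$ for $\Lambda=1,0,-1$. On $\mathbb R^4$ let $\langle y,y\rangle_\Lambda=-y_1^2+\Lambda y_2^2+y_3^2+y_4^2$. Let $\mathbb Y_\Lambda\subset\mathbb{RP}^3$ be the set of lines on which this form is negative (hyperbolic space for $\Lambda=1$, half-pipe space for $\Lambda=0$, anti-de Sitter space for $\Lambda=-1$), and let $\partial_\infty\mathbb Y_\Lambda$ be the set of lines on which it vanishes. The volume form of $\mathbb Y_\Lambda$ is the $3$-form induced by $(u,v,w)\mapsto\det(y,u,v,w)$ on $\{\langle y,y\rangle_\Lambda=-1\}$, up to sign; for $\Lambda=\pm1$ it is the volume form of the induced metric of curvature $-1$. Identify $\mathbb R^4$ with the hermitian $2\times2$-matrices over $\mathbb C_\Lambda$ by $$y\mapsto\begin{pmatrix}y_1+y_3&y_4+\ell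 y_2\\ y_4-\ell y_2&y_1-y_3\end{pmatrix}.$$ Then the matrices $B\in\mathrm{Mat}(2,\mathbb C_\Lambda)$ with $|\det B|^2>0$, modulo $\mathbb C_\Lambda^\times$, form a group $\mathrm{PGL}^+(2,\mathbb C_\Lambda)$ that acts on $\mathbb Y_\Lambda$ and $\partial_\infty\mathbb Y_\Lambda$ by $[y]\mapsto[ByB^\dagger]$, where $B^\dagger$ is the conjugate transpose; the volume form is invariant under this action. An *ideal tetrahedron* $\Theta\subset\mathbb Y_\Lambda$ is a geodesic $3$-simplex which is the projection of the convex cone over four linearly independent vectors of $\mathbb R^4$, whose vertices lie in $\partial_\infty\mathbb Y_\Lambda$, whose other points lie in $\mathbb Y_\Lambda$, and whose edges are spacelike. Real numbers $\alpha,\beta,\gamma$ with $\alpha+\beta+\gamma=0$ and $s_\Lambda(\alpha)\neq0$ are called *generalized dihedral angles* of $\Theta$, with vertices labelled $y_1,y_2,y_3,y_4$, if some $B\in\mathrm{PGL}^+(2,\mathbb C_\Lambda)$ maps $y_1,y_2,y_3,y_4$ to the classes of $$\begin{pmatrix}1&0\\0&0\end{pmatrix},\quad\begin{pmatrix}0&0\\0&1\end{pmatrix},\quad\begin{pmatrix}1&1\\1&1\end{pmatrix},\quad\begin{pmatrix}|z|^2&z\\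 \bar z&1\end{pmatrix},\qquad z=-\frac{s_\Lambda(\beta)}{s_\Lambda(\alpha)}\,e^{\ell\gamma}.$$ The generalized Clausen function is $$\mathrm{Cl}_\Lambda(a)=-\int_0^a\log\bigl|2s_\Lambda(\tfrac\theta2)\bigr|\,d\theta .$$ **Theorem.** Let $\Theta\subset\mathbb Y_\Lambda$ be an ideal tetrahedron with labelled vertices. Then: 1. $\Theta$ has generalized dihedral angles $\alpha,\beta,\gamma$; for $\Lambda=1$ they can be chosen with $0<|\alpha|,|\beta|,|\gamma|<\pi$. After a suitable relabelling of the vertices they can be chosen with $\alpha,\beta>0$, and with $\alpha+\beta<\pi$ if $\Lambda=1$. 2. The volume of $\Theta$ is finite. For every labelling of the vertices and all generalized dihedral angles $\alpha,\beta,\gamma=-(\alpha+\beta)$ for it with $\alpha,\beta>0$, and with $\alpha+\beta<\pi$ if $\Lambda=1$, $$\mathrm{vol}(\Theta)=\tfrac12\bigl(\mathrm{Cl}_\Lambda(2\alpha)+\mathrm{Cl}_\Lambda(2\beta)+\mathrm{Cl}_\Lambda(2\gamma)\bigr).$$ 3. For generalized dihedral angles $\alpha,\beta,\gamma$ of any signs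 the right-hand side equals $\varepsilon\,\mathrm{vol}(\Theta)$, where $\varepsilon=\pm1$ is the orientation of the labelled vertices, normalized so that $\varepsilon=1$ when $\mathrm{Im}\,z>0$. -/

import Mathlib

open scoped LinearAlgebra.Projectivization Matrix ENNReal

noncomputable section

namespace GenIdeal

/-! The parameter `Λ ∈ {-1, 0, 1}` is an element of `SignType`, coerced to `ℝ` where needed. -/

/-! ### Generalized complex numbers and generalized trigonometric functions -/

/-- The ring `ℂ_Λ = ℝ[ℓ] / (ℓ² + Λ)`; `star` is the conjugation `x + ℓ y ↦ x - ℓ y` and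
`QuadraticAlgebra.norm z` is `|z|² = z * star z = x² + Λ y²`. -/
abbrev GenComplex (Λ : SignType) : Type := QuadraticAlgebra ℝ (-(Λ : ℝ)) 0

/-- The generalized cosine `c_Λ`. -/
def genCos : SignType → ℝ → ℝ
  | .pos, θ => Real.cos θ
  | .zero, _ => 1
  | .neg, θ => Real.cosh θ

/-- The generalized sine `s_Λ`. -/
def genSin : SignType → ℝ → ℝ
  | .pos, θ => Real.sin θ
  | .zero, θ => θ
  | .neg, θ => Real.sinh θ

/-- `exp (ℓ θ) = c_Λ(θ) + ℓ s_Λ(θ)`. -/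
def genExp (Λ : SignType) (θ : ℝ) : GenComplex Λ := ⟨genCos Λ θ, genSin Λ θ⟩

/-- The generalized Clausen function `Cl_Λ(a) = - ∫₀ᵃ log |2 s_Λ(θ/2)| dθ`. -/
def genClausen (Λ : SignType) (a : ℝ) : ℝ :=
  -∫ θ in (0 : ℝ)..a, Real.log |2 * genSin Λ (θ / 2)|

/-! ### The projective quadric `Y_Λ`, its ideal boundary and its metric -/

/-- The bilinear form `-x₁y₁ + Λ x₂y₂ + x₃y₃ + x₄y₄` on `ℝ⁴`. -/
def form (Λ : SignType) (x y : Fin 4 → ℝ) : ℝ :=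
  -(x 0 * y 0) + (Λ : ℝ) * (x 1 * y 1) + x 2 * y 2 + x 3 * y 3

/-- Real projective space `ℝP³`. -/
abbrev RP3 : Type := ℙ ℝ (Fin 4 → ℝ)

/-- `Y_Λ ⊆ ℝP³`, the set of timelike lines: hyperbolic space for `Λ = 1`, half-pipe
(co-Minkowski) space for `Λ = 0`, anti-de Sitter space for `Λ = -1`. -/
def Y (Λ : SignType) : Set RP3 :=
  {P | ∀ y ∈ P.submodule, y ≠ 0 → form Λ y y < 0}

/-- The ideal boundary of `Y_Λ`, the projective lightcone. -/
def idealBoundary (Λ : SignType) : Set RP3 :=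
  {P | ∀ y ∈ P.submodule, form Λ y y = 0}

/-- The (semi-Riemannian, degenerate for `Λ = 0`) metric of `Y_Λ` at the point `[y]`. Tangent
vectors at `[y]` are vectors of `ℝ⁴` modulo `ℝ y`, attached to the representative `y`. On
representatives with `⟨y, y⟩ = -1` and vectors orthogonal to `y` this is the ambient form. -/
def metric (Λ : SignType) (y u w : Fin 4 → ℝ) : ℝ :=
  -(form Λ u w * form Λ y y - form Λ u y * form Λ w y) / form Λ y y ^ 2

/-- The geodesic of `Y_Λ` which is cut out by the linear plane `W` is nonempty, and all its
tangent vectors are spacelike. -/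
def IsSpacelikeGeodesic (Λ : SignType) (W : Submodule ℝ (Fin 4 → ℝ)) : Prop :=
  Module.finrank ℝ W = 2 ∧ (∃ y ∈ W, form Λ y y < 0) ∧
    ∀ y ∈ W, form Λ y y < 0 → ∀ u ∈ W, u ∉ Submodule.span ℝ {y} → 0 < metric Λ y u u

/-! ### The volume -/

/-- The volume form of `Y_Λ` at `[y]`, evaluated on tangent vectors as in `metric`. On
representatives with `⟨y, y⟩ = -1` it is the contraction of the standard volume form of `ℝ⁴`
with the position vector `y`. -/
def volForm (Λ : SignType) (y u v w : Fin 4 → ℝ) : ℝ :=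
  (Matrix.of ![y, u, v, w]).det / form Λ y y ^ 2

/-- The affine chart `x ↦ (1, x₁, x₂, x₃)` of `ℝP³`. It omits only the points with first
coordinate zero, which form the empty set or a totally geodesic surface in `Y_Λ`. -/
def chart (x : Fin 3 → ℝ) : Fin 4 → ℝ := ![1, x 0, x 1, x 2]

theorem chart_ne_zero (x : Fin 3 → ℝ) : chart x ≠ 0 := fun h => by
  simpa [chart] using congrFun h 0

/-- The volume of a subset of `Y_Λ`: the integral of (the absolute value of) the volume form in
the affine chart, whose coordinate vector fields are the last three standard basis vectors. -/
def vol (Λ : SignType) (S : Set RP3) : ℝ≥0∞ :=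
  ∫⁻ x in {x : Fin 3 → ℝ | Projectivization.mk ℝ (chart x) (chart_ne_zero x) ∈ S ∩ Y Λ},
    ENNReal.ofReal |volForm Λ (chart x) ![0, 1, 0, 0] ![0, 0, 1, 0] ![0, 0, 0, 1]|

/-! ### The matrix model and the isometries -/

/-- The identification of `ℝ⁴` with the hermitian `2 × 2`-matrices over `ℂ_Λ`. -/
def toMat (Λ : SignType) (y : Fin 4 → ℝ) : Matrix (Fin 2) (Fin 2) (GenComplex Λ) :=
  !![⟨y 0 + y 2, 0⟩, ⟨y 3, y 1⟩; ⟨y 3, -y 1⟩, ⟨y 0 - y 2, 0⟩]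

/-- `B` represents an element of `PGL⁺(2, ℂ_Λ)`, i.e. `|det B|² > 0`. This group acts on `Y_Λ` and
on its ideal boundary by `[y] ↦ [B y B†]`, in terms of hermitian matrices. -/
def IsPGLPlus {Λ : SignType} (B : Matrix (Fin 2) (Fin 2) (GenComplex Λ)) : Prop :=
  0 < QuadraticAlgebra.norm B.det

/-! The next three facts say that `volForm` is a well defined form on `Y_Λ`, that it is the volume
form of the metric for `Λ = ± 1`, and that it is `PGL⁺(2, ℂ_Λ)`-invariant for all `Λ`. -/

theorem volForm_rescale (Λ : SignType) (y u v w : Fin 4 → ℝ) (c p q r : ℝ) (hc : c ≠ 0) :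
    volForm Λ (c • y) (c • u + p • y) (c • v + q • y) (c • w + r • y) = volForm Λ y u v w := by
  have h1 : (Matrix.of ![c • y, c • u + p • y, c • v + q • y, c • w + r • y]).det =
      c ^ 4 * (Matrix.of ![y, u, v, w]).det := by
    simp [Matrix.det_succ_row_zero, Fin.sum_univ_succ, Fin.succAbove]
    ring
  have h2 : form Λ (c • y) (c • y) = c ^ 2 * form Λ y y := by
    simp [form]; ring
  unfold volForm
  rw [h1, h2, mul_pow, ← pow_mul, mul_div_mul_left _ _ (pow_ne_zero _ hc)]

theorem det_metric (Λ : SignType) (y : Fin 4 → ℝ) (hy : form Λ y y < 0) (u : Fin 3 → Fin 4 → ℝ) :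
    (Matrix.of fun i j => metric Λ y (u i) (u j)).det =
      (Λ : ℝ) * volForm Λ y (u 0) (u 1) (u 2) ^ 2 := by
  classical
  have hG : ∀ a b c d : Fin 4 → ℝ, (Matrix.of ![
      ![form Λ a a, form Λ a b, form Λ a c, form Λ a d],
      ![form Λ b a, form Λ b b, form Λ b c, form Λ b d],
      ![form Λ c a, form Λ c b, form Λ c c, form Λ c d],
      ![form Λ d a, form Λ d b, form Λ d c, form Λ d d]]).det =
      -(Λ : ℝ) * (Matrix.of ![a, b, c, d]).det ^ 2 := by
    intro a b c d
    have : (Matrix.of ![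
      ![form Λ a a, form Λ a b, form Λ a c, form Λ a d],
      ![form Λ b a, form Λ b b, form Λ b c, form Λ b d],
      ![form Λ c a, form Λ c b, form Λ c c, form Λ c d],
      ![form Λ d a, form Λ d b, form Λ d c, form Λ d d]]) =
      Matrix.of ![a, b, c, d] * Matrix.diagonal ![-1, (Λ : ℝ), 1, 1] *
        (Matrix.of ![a, b, c, d])ᵀ := by
      ext i j
      rw [Matrix.mul_apply]
      simp only [Matrix.mul_diagonal, Matrix.transpose_apply, Fin.sum_univ_four]
      fin_cases i <;> fin_cases j <;> simp [form] <;> ring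
    rw [this, Matrix.det_mul, Matrix.det_mul, Matrix.det_transpose, Matrix.det_diagonal]
    simp [Fin.prod_univ_succ]
    ring
  have hs : ∀ a b, form Λ a b = form Λ b a := fun a b => by simp only [form]; ring
  have h := hG y (u 0) (u 1) (u 2)
  have hne := hy.ne
  unfold volForm
  rw [div_pow, ← mul_div_assoc, eq_div_iff (by positivity)]
  have h' : (Λ : ℝ) * (Matrix.of ![y, u 0, u 1, u 2]).det ^ 2 = -(Matrix.of ![
      ![form Λ y y, form Λ y (u 0), form Λ y (u 1), form Λ y (u 2)],
      ![form Λ (u 0) y, form Λ (u 0) (u 0), form Λ (u 0) (u 1), form Λ (u 0) (u 2)],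
      ![form Λ (u 1) y, form Λ (u 1) (u 0), form Λ (u 1) (u 1), form Λ (u 1) (u 2)],
      ![form Λ (u 2) y, form Λ (u 2) (u 0), form Λ (u 2) (u 1), form Λ (u 2) (u 2)]]).det := by
    rw [h]; ring
  rw [h', Matrix.det_fin_three]
  simp only [Matrix.of_apply, metric]
  rw [hs y (u 0), hs y (u 1), hs y (u 2), hs (u 1) (u 0), hs (u 2) (u 0), hs (u 2) (u 1)]
  generalize form Λ y y = g at *
  generalize form Λ (u 0) y = a0
  generalize form Λ (u 1) y = a1
  generalize form Λ (u 2) y = a2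
  generalize form Λ (u 0) (u 0) = g00
  generalize form Λ (u 0) (u 1) = g01
  generalize form Λ (u 0) (u 2) = g02
  generalize form Λ (u 1) (u 1) = g11
  generalize form Λ (u 1) (u 2) = g12
  generalize form Λ (u 2) (u 2) = g22
  simp [Matrix.det_succ_row_zero, Fin.sum_univ_succ, Fin.succAbove]
  field_simp
  ring

theorem volForm_invariant (Λ : SignType) (B : Matrix (Fin 2) (Fin 2) (GenComplex Λ))
    (hB : IsPGLPlus B) {y u v w y' u' v' w' : Fin 4 → ℝ}
    (hy : toMat Λ y' = B * toMat Λ y * Bᴴ) (hu : toMat Λ u' = B * toMat Λ u * Bᴴ)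
    (hv : toMat Λ v' = B * toMat Λ v * Bᴴ) (hw : toMat Λ w' = B * toMat Λ w * Bᴴ) :
    volForm Λ y' u' v' w' = volForm Λ y u v w := by
  obtain ⟨a, b, c, d, rfl⟩ : ∃ a b c d, B = !![a, b; c, d] :=
    ⟨_, _, _, _, Matrix.eta_fin_two B⟩
  obtain ⟨a0, a1⟩ := a
  obtain ⟨b0, b1⟩ := b
  obtain ⟨c0, c1⟩ := c
  obtain ⟨d0, d1⟩ := d
  generalize hL : (Λ : ℝ) = L
  have hN : QuadraticAlgebra.norm
      (!![⟨a0, a1⟩, ⟨b0, b1⟩; ⟨c0, c1⟩, ⟨d0, d1⟩] : Matrix _ _ (GenComplex Λ)).det =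
      (a0 * d0 - L * a1 * d1 - b0 * c0 + L * b1 * c1) ^ 2 +
        L * (a0 * d1 + a1 * d0 - b0 * c1 - b1 * c0) ^ 2 := by
    rw [Matrix.det_fin_two_of]
    simp [QuadraticAlgebra.norm_def, hL]
    ring
  unfold IsPGLPlus at hB
  rw [hN] at hB
  set N := (a0 * d0 - L * a1 * d1 - b0 * c0 + L * b1 * c1) ^ 2 +
        L * (a0 * d1 + a1 * d0 - b0 * c1 - b1 * c0) ^ 2 with hNdef
  -- the action in the coordinates `y₁ + y₃, y₁ - y₃, y₄, y₂`
  let Q : Matrix (Fin 4) (Fin 4) ℝ :=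
    !![a0 ^ 2 + L * a1 ^ 2, b0 ^ 2 + L * b1 ^ 2, 2 * (a0 * b0 + L * a1 * b1),
        2 * L * (a0 * b1 - a1 * b0);
      c0 ^ 2 + L * c1 ^ 2, d0 ^ 2 + L * d1 ^ 2, 2 * (c0 * d0 + L * c1 * d1),
        2 * L * (c0 * d1 - c1 * d0);
      a0 * c0 + L * a1 * c1, b0 * d0 + L * b1 * d1,
        a0 * d0 + b0 * c0 + L * (a1 * d1 + b1 * c1),
        L * (a0 * d1 - a1 * d0 + b1 * c0 - b0 * c1);
      a1 * c0 - a0 * c1, b1 * d0 - b0 * d1, a1 * d0 - a0 * d1 + b1 * c0 - b0 * c1,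
        a0 * d0 - b0 * c0 + L * (a1 * d1 - b1 * c1)]
  let C : (Fin 4 → ℝ) → Fin 4 → ℝ := fun x => ![x 0 + x 2, x 0 - x 2, x 3, x 1]
  have hQ : Q.det = N ^ 2 := by
    simp [Q, Matrix.det_succ_row_zero, Fin.sum_univ_succ, Fin.succAbove]
    rw [hNdef]
    ring
  have key : ∀ x x' : Fin 4 → ℝ,
      toMat Λ x' = !![⟨a0, a1⟩, ⟨b0, b1⟩; ⟨c0, c1⟩, ⟨d0, d1⟩] * toMat Λ x *
        !![⟨a0, a1⟩, ⟨b0, b1⟩; ⟨c0, c1⟩, ⟨d0, d1⟩]ᴴ → C x' = Q *ᵥ C x := by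
    intro x x' h
    have h00 := congrArg QuadraticAlgebra.re (congrFun (congrFun h 0) 0)
    have h11 := congrArg QuadraticAlgebra.re (congrFun (congrFun h 1) 1)
    have h01 := congrArg QuadraticAlgebra.re (congrFun (congrFun h 0) 1)
    have h02 := congrArg QuadraticAlgebra.im (congrFun (congrFun h 0) 1)
    simp [toMat, Matrix.mul_apply, Fin.sum_univ_succ, hL] at h00 h11 h01 h02
    ext i
    simp only [Matrix.mulVec, dotProduct, Fin.sum_univ_four]
    fin_cases i <;> simp [C, Q]
    · rw [h00]; ring
    · rw [h11]; ring
    · rw [h01]; ring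
    · rw [h02]; ring
  have hform : ∀ x, form Λ x x = -(C x 0 * C x 1 - C x 2 ^ 2 - L * C x 3 ^ 2) := by
    intro x; simp [form, C, hL]; ring
  have hC : ∀ p q r s : Fin 4 → ℝ,
      (Matrix.of ![C p, C q, C r, C s]).det = -2 * (Matrix.of ![p, q, r, s]).det := by
    intro p q r s
    simp [C, Matrix.det_succ_row_zero, Fin.sum_univ_succ, Fin.succAbove]
    ring
  have hdet : (Matrix.of ![y', u', v', w']).det = N ^ 2 * (Matrix.of ![y, u, v, w]).det := by
    have h : (Matrix.of ![C y', C u', C v', C w']) = Matrix.of ![C y, C u, C v, C w] * Qᵀ := by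
      rw [key _ _ hy, key _ _ hu, key _ _ hv, key _ _ hw]
      ext i j
      rw [Matrix.mul_apply]
      fin_cases i <;> simp [Matrix.mulVec, dotProduct, mul_comm]
    have h2 := congrArg Matrix.det h
    rw [Matrix.det_mul, Matrix.det_transpose, hQ, hC, hC] at h2
    linarith
  have hf : form Λ y' y' = N * form Λ y y := by
    rw [hform, hform, key _ _ hy]
    generalize C y = x
    simp [Q, Matrix.mulVec, dotProduct, Fin.sum_univ_four]
    rw [hNdef]
    ring
  unfold volForm
  rw [hdet, hf, mul_pow, mul_div_mul_left _ _ (pow_ne_zero _ hB.ne')]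

/-! ### Ideal tetrahedra -/

/-- An ideal tetrahedron in `Y_Λ` with labelled vertices: a non-degenerate convex geodesic
3-simplex, i.e. the projection of the convex cone over four linearly independent vectors, such
that the vertices are on the ideal boundary, all other points are in `Y_Λ`, and all edges are
spacelike. -/
structure IdealTetrahedron (Λ : SignType) where
  /-- Representatives of the vertices, generating the cone. -/
  lift : Fin 4 → Fin 4 → ℝ
  indep : LinearIndependent ℝ lift
  vertex_mem : ∀ i, Projectivization.mk ℝ (lift i) (indep.ne_zero i) ∈ idealBoundary Λ
  interior_mem : ∀ (b : Fin 4 → ℝ) (h : ∑ i, b i • lift i ≠ 0), (∀ i, 0 ≤ b i) →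
    (∀ j, Projectivization.mk ℝ (∑ i, b i • lift i) h ≠
      Projectivization.mk ℝ (lift j) (indep.ne_zero j)) →
    Projectivization.mk ℝ (∑ i, b i • lift i) h ∈ Y Λ
  edge_spacelike : ∀ i j, i ≠ j → IsSpacelikeGeodesic Λ (Submodule.span ℝ {lift i, lift j})

/-- The set of points of `Y_Λ` in the ideal tetrahedron. -/
def IdealTetrahedron.carrier {Λ : SignType} (T : IdealTetrahedron Λ) : Set RP3 :=
  {P | P ∈ Y Λ ∧ ∃ (b : Fin 4 → ℝ) (h : ∑ i, b i • T.lift i ≠ 0),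
    (∀ i, 0 ≤ b i) ∧ P = Projectivization.mk ℝ (∑ i, b i • T.lift i) h}

/-- The orientation sign of the labelled vertices. It does not change if all lifts are multiplied
by `-1`, and it is `1` for the vertices `∞, 0, 1, z` with `Im z > 0`. -/
def IdealTetrahedron.orientation {Λ : SignType} (T : IdealTetrahedron Λ) : SignType :=
  SignType.sign (-(Matrix.of T.lift).det)

/-- The isometry given by `B` maps `[y₁], …, [y₄]` to the standard position `∞, 0, 1, z` with
`z = -(s_Λ(β) / s_Λ(α)) exp(ℓ γ)`, where `α + β + γ = 0`. If this holds for the vertices of an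
ideal tetrahedron, then `α, β, γ` are its generalized dihedral angles. -/
def HasDihedralAngles (Λ : SignType) (y : Fin 4 → Fin 4 → ℝ)
    (B : Matrix (Fin 2) (Fin 2) (GenComplex Λ)) (α β γ : ℝ) : Prop :=
  let q : ℝ := genSin Λ β / genSin Λ α
  let M : Fin 4 → Matrix (Fin 2) (Fin 2) (GenComplex Λ) :=
    ![!![1, 0; 0, 0], !![0, 0; 0, 1], !![1, 1; 1, 1],
      !![⟨q ^ 2, 0⟩, -(q • genExp Λ γ); -(q • genExp Λ (-γ)), 1]]
  α + β + γ = 0 ∧ genSin Λ α ≠ 0 ∧ IsPGLPlus B ∧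
    ∀ i, ∃ c : ℝ, c ≠ 0 ∧ B * toMat Λ (y i) * Bᴴ = c • M i

end GenIdeal

end

noncomputable section

namespace GenIdeal

open MeasureTheory Set Filter Topology

/-! ### Generalized trigonometric identities -/

/-! Volume. Use coordinates `b` with respect to lifts of the vertices. When `α, β > 0`, the lifts
can be rescaled so that minus the ambient form becomes `angleForm` and their determinant becomes
`-s(α) s(β) s(α+β) / 2` (`IdealTetrahedron.vol_of_pos_angles`). For a quadratic form `q`, the chart
integral of `q⁻²` over a double cone is twice the Lebesgue measure of the part with `q < 1`. A
linear change of basis therefore costs only `|det|` (`volume_cone`, `lintegral_chart_vecMul`), and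
the volume is `|det|` times an integral of `q⁻²` over the positive octant.

Two of the three integrations are elementary and leave `log (k p / r) / (k p - r)`, where `k p - r`
is quadratic in the remaining variable `t`. The substitution `t = s(α+β) s(β-φ) / (s(α) s(φ))` turns
`k p - r` into a constant over `s(φ)²`, which cancels the Jacobian, and turns `k p / r` into a
quotient of products of sines (`lintegral_angleParam_slice`). Integrating four terms `log |2 s|`
over `0 < φ < β` gives the Clausen sum. Apart from sign and range facts, only the addition theorems
and `c² + Λ s² = 1` enter, so the three geometries are treated together.

Angles. Relevant null vectors are real multiples of `v v†`, and `B` acts by `v ↦ B v`. An explicit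
matrix sends three vertices to `∞, 0, 1` and the fourth to some `z`
(`IsIdealFrame.exists_standard`). Polar coordinates of `z` and `z - 1` give the angles, by the law
of sines in the triangle `0, 1, z`.

Signs. The Clausen sum is symmetric and odd. The relabellings `z ↦ 1/z` and `z ↦ 1/(1-z)`, and
shifts by multiples of `π` for `Λ = 1`, reduce every choice of angles to `α, β > 0`. The sign of the
relabelling is the orientation. -/

theorem genSin_add (Λ : SignType) (x y : ℝ) :
    genSin Λ (x + y) = genSin Λ x * genCos Λ y + genCos Λ x * genSin Λ y := by
  cases Λ
  · simp [genSin, genCos]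
  · exact Real.sinh_add x y
  · exact Real.sin_add x y

theorem genCos_add (Λ : SignType) (x y : ℝ) :
    genCos Λ (x + y) = genCos Λ x * genCos Λ y - (Λ : ℝ) * (genSin Λ x * genSin Λ y) := by
  cases Λ
  · simp [genCos, SignType.cast]
  · simp [genCos, genSin, SignType.cast, Real.cosh_add]
  · simp [genCos, genSin, SignType.cast, Real.cos_add]

theorem genSin_neg (Λ : SignType) (x : ℝ) : genSin Λ (-x) = -genSin Λ x := by
  cases Λ <;> simp [genSin]

theorem genCos_neg (Λ : SignType) (x : ℝ) : genCos Λ (-x) = genCos Λ x := by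
  cases Λ <;> simp [genCos]

theorem genSin_sub (Λ : SignType) (x y : ℝ) :
    genSin Λ (x - y) = genSin Λ x * genCos Λ y - genCos Λ x * genSin Λ y := by
  rw [sub_eq_add_neg, genSin_add, genSin_neg, genCos_neg]; ring

theorem genCos_sq (Λ : SignType) (x : ℝ) :
    genCos Λ x ^ 2 = 1 - (Λ : ℝ) * genSin Λ x ^ 2 := by
  cases Λ
  · simp [genCos, SignType.cast]
  · simp [genCos, genSin, SignType.cast, Real.cosh_sq]; ring
  · simp [genCos, genSin, SignType.cast, Real.cos_sq']

@[simp] theorem genSin_zero (Λ : SignType) : genSin Λ 0 = 0 := by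
  cases Λ <;> simp [genSin]

@[simp] theorem genCos_zero (Λ : SignType) : genCos Λ 0 = 1 := by
  cases Λ <;> simp [genCos]

theorem hasDerivAt_genSin (Λ : SignType) (x : ℝ) : HasDerivAt (genSin Λ) (genCos Λ x) x := by
  cases Λ
  · exact hasDerivAt_id x
  · exact Real.hasDerivAt_sinh x
  · exact Real.hasDerivAt_sin x

@[fun_prop] theorem continuous_genSin (Λ : SignType) : Continuous (genSin Λ) :=
  continuous_iff_continuousAt.2 fun x => (hasDerivAt_genSin Λ x).continuousAt

theorem genSin_pos (Λ : SignType) {x : ℝ} (hx : 0 < x) (h : Λ = 1 → x < Real.pi) :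
    0 < genSin Λ x := by
  cases Λ
  · exact hx
  · exact Real.sinh_pos_iff.2 hx
  · exact Real.sin_pos_of_pos_of_lt_pi hx (h rfl)

theorem genSin_eq_zero_iff {Λ : SignType} (hΛ : Λ ≠ 1) {x : ℝ} : genSin Λ x = 0 ↔ x = 0 := by
  cases Λ
  · exact Iff.rfl
  · exact Real.sinh_eq_zero
  · exact absurd rfl hΛ

theorem genSin_one (x : ℝ) : genSin 1 x = Real.sin x := rfl

theorem genCos_one (x : ℝ) : genCos 1 x = Real.cos x := rfl

theorem analyticAt_genSin (Λ : SignType) (x : ℝ) : AnalyticAt ℝ (genSin Λ) x := by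
  cases Λ
  · exact analyticAt_id
  · exact Real.analyticAt_sinh
  · exact Real.analyticAt_sin

/-- Generalized polar coordinates. -/
theorem exists_genPolar (Λ : SignType) (x y : ℝ) (h : 0 < x ^ 2 + (Λ : ℝ) * y ^ 2) :
    ∃ ρ θ : ℝ, ρ ≠ 0 ∧ x = ρ * genCos Λ θ ∧ y = ρ * genSin Λ θ := by
  cases Λ
  · have hx : x ≠ 0 := by
      rintro rfl
      simp [SignType.cast] at h
    exact ⟨x, y / x, hx, by simp [genCos], by simp [genSin]; field_simp⟩
  · simp only [SignType.cast] at h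
    set r := Real.sqrt (x ^ 2 - y ^ 2) with hr
    have hr2 : r ^ 2 = x ^ 2 - y ^ 2 := Real.sq_sqrt (by linarith)
    have hr0 : 0 < r := Real.sqrt_pos.2 (by linarith)
    -- Since `cosh` is positive, the radius has to carry the sign of `x`.
    have key : ∀ ρ : ℝ, ρ ^ 2 = r ^ 2 → 0 < x / ρ → ∃ θ : ℝ, ρ ≠ 0 ∧
        x = ρ * Real.cosh θ ∧ y = ρ * Real.sinh θ := by
      intro ρ hρ hxρ
      have hρ0 : ρ ≠ 0 := by rintro rfl; simp at hxρ
      have hs : y = ρ * Real.sinh (Real.arsinh (y / ρ)) := by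
        rw [Real.sinh_arsinh]; field_simp
      refine ⟨Real.arsinh (y / ρ), hρ0, ?_, hs⟩
      have hc : Real.cosh (Real.arsinh (y / ρ)) ^ 2 = (x / ρ) ^ 2 := by
        rw [Real.cosh_sq, Real.sinh_arsinh, div_pow, div_pow]
        field_simp
        rw [hρ, hr2]; ring
      rw [(pow_left_inj₀ (Real.cosh_pos _).le hxρ.le two_ne_zero).1 hc]
      field_simp
    rcases lt_or_ge 0 x with hx | hx
    · obtain ⟨θ, h⟩ := key r rfl (by positivity)
      exact ⟨r, θ, h⟩
    · have hx : x < 0 := lt_of_le_of_ne hx (by rintro rfl; nlinarith)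
      obtain ⟨θ, h⟩ := key (-r) (by ring) (div_pos_of_neg_of_neg hx (by linarith))
      exact ⟨-r, θ, h⟩
  · simp only [SignType.cast] at h
    have hz : (⟨x, y⟩ : ℂ) ≠ 0 := by
      intro h0
      have h1 := congrArg Complex.re h0
      have h2 := congrArg Complex.im h0
      simp at h1 h2
      simp [h1, h2] at h
    exact ⟨‖(⟨x, y⟩ : ℂ)‖, Complex.arg ⟨x, y⟩, by simpa using hz,
      (Complex.norm_mul_cos_arg ⟨x, y⟩).symm, (Complex.norm_mul_sin_arg ⟨x, y⟩).symm⟩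

/-! ### The generalized Lobachevsky function -/

/-- The primitive `∫₀ᵃ log |2 s_Λ(θ)| dθ` of `log |2 s_Λ|`. -/
def logSinInt (Λ : SignType) (a : ℝ) : ℝ := ∫ θ in (0 : ℝ)..a, Real.log |2 * genSin Λ θ|

theorem genClausen_two_mul (Λ : SignType) (a : ℝ) :
    genClausen Λ (2 * a) = -2 * logSinInt Λ a := by
  unfold genClausen logSinInt
  rw [intervalIntegral.integral_comp_div (fun θ => Real.log |2 * genSin Λ θ|) two_ne_zero]
  simp

/-- The logarithmic singularities at the zeros of `s_Λ` are integrable, as for any meromorphic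
function. -/
theorem intervalIntegrable_log_genSin (Λ : SignType) (a b : ℝ) :
    IntervalIntegrable (fun θ => Real.log |2 * genSin Λ θ|) volume a b := by
  have : MeromorphicOn (fun θ => 2 * genSin Λ θ) (uIcc a b) := fun x _ =>
    (analyticAt_const.mul (analyticAt_genSin Λ x)).meromorphicAt
  simpa using this.intervalIntegrable_log_norm

theorem logSinInt_neg (Λ : SignType) (a : ℝ) : logSinInt Λ (-a) = -logSinInt Λ a := by
  unfold logSinInt
  have h := intervalIntegral.integral_comp_neg (a := 0) (b := a)
    (fun θ => Real.log |2 * genSin Λ θ|)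
  simp only [genSin_neg, mul_neg, abs_neg, neg_zero] at h
  rw [h, intervalIntegral.integral_symm]

theorem integral_log_genSin (Λ : SignType) (a b : ℝ) :
    ∫ θ in a..b, Real.log |2 * genSin Λ θ| = logSinInt Λ b - logSinInt Λ a := by
  unfold logSinInt
  rw [intervalIntegral.integral_interval_sub_left] <;> exact intervalIntegrable_log_genSin _ _ _

/-- The factor 2 inside the logarithm makes the integral over a period vanish, because `∫₀^π log sin
= -π log 2`. -/
theorem logSinInt_add_pi (a : ℝ) : logSinInt 1 (a + Real.pi) = logSinInt 1 a := by
  rw [← sub_eq_zero, ← integral_log_genSin]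
  have hper : Function.Periodic (fun θ => Real.log |2 * genSin 1 θ|) Real.pi := by
    intro x
    simp [genSin_one, Real.sin_add_pi]
  rw [hper.intervalIntegral_add_eq a 0, zero_add]
  have h : ∫ θ in (0 : ℝ)..Real.pi, Real.log |2 * genSin 1 θ| =
      ∫ θ in (0 : ℝ)..Real.pi, (Real.log 2 + Real.log (Real.sin θ)) := by
    apply intervalIntegral.integral_congr_ae
    have h0 : ∀ᵐ θ : ℝ, θ ≠ Real.pi := by simp [ae_iff]
    filter_upwards [h0] with θ hθ hmem
    rw [uIoc_of_le Real.pi_pos.le] at hmem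
    have : 0 < Real.sin θ := Real.sin_pos_of_pos_of_lt_pi hmem.1 (lt_of_le_of_ne hmem.2 hθ)
    rw [genSin_one, abs_of_pos (by positivity), Real.log_mul two_ne_zero this.ne']
  rw [h, intervalIntegral.integral_add (by simp)
    (show IntervalIntegrable (fun θ => Real.log (Real.sin θ)) volume _ _ from
      intervalIntegrable_log_sin), integral_log_sin_zero_pi]
  simp
  ring

/-- The right hand side of the volume formula. -/
def clausenSum (Λ : SignType) (α β γ : ℝ) : ℝ :=
  1 / 2 * (genClausen Λ (2 * α) + genClausen Λ (2 * β) + genClausen Λ (2 * γ))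

theorem clausenSum_eq (Λ : SignType) (α β γ : ℝ) :
    clausenSum Λ α β γ = -(logSinInt Λ α + logSinInt Λ β + logSinInt Λ γ) := by
  simp only [clausenSum, genClausen_two_mul]; ring

end GenIdeal

end

noncomputable section

namespace GenIdeal

open MeasureTheory Set Filter Topology

/-! ### Volumes of cones in `ℝ⁴` and integrals in the affine chart -/

theorem lintegral_eq_abs_pow_mul_lintegral_comp_smul {n : ℕ} (f : (Fin n → ℝ) → ℝ≥0∞)
    (hf : Measurable f) {t : ℝ} (ht : t ≠ 0) :
    ∫⁻ x, f x = ENNReal.ofReal |t ^ n| * ∫⁻ x, f (t • x) := by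
  have h := Measure.map_addHaar_smul (volume : Measure (Fin n → ℝ)) ht
  have h2 : ∫⁻ x, f (t • x) = ∫⁻ x, f x ∂(Measure.map (t • ·) volume) :=
    (lintegral_map hf (measurable_const_smul t)).symm
  rw [h2, h, lintegral_smul_measure, smul_eq_mul, ← mul_assoc, ← ENNReal.ofReal_mul (abs_nonneg _),
    ← abs_mul]
  simp [ht]

/-- The radial integral for `volume_cone`; `|t|³` is the Jacobian of `(t, x) ↦ t • chart x`. -/
theorem lintegral_Ioo_abs_pow_three {s : ℝ} (hs : 0 ≤ s) :
    ∫⁻ t in Ioo (-s) s, ENNReal.ofReal |t ^ 3| = ENNReal.ofReal (s ^ 4 / 2) := by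
  have hc : Continuous fun t : ℝ => |t ^ 3| := by fun_prop
  rw [← ofReal_integral_eq_lintegral_ofReal
    ((hc.integrableOn_Icc (a := -s) (b := s)).mono_set Ioo_subset_Icc_self)
    (Eventually.of_forall fun t => abs_nonneg _), ← integral_Ioc_eq_integral_Ioo,
    ← intervalIntegral.integral_of_le (by linarith)]
  congr 1
  have h1 : ∫ t in (0 : ℝ)..s, |t ^ 3| = s ^ 4 / 4 := by
    rw [intervalIntegral.integral_congr (g := fun t => t ^ 3)]
    · simp; norm_num
    · intro t ht
      rw [uIcc_of_le hs] at ht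
      exact abs_of_nonneg (pow_nonneg ht.1 3)
  have h2 : ∫ t in (-s : ℝ)..0, |t ^ 3| = s ^ 4 / 4 := by
    rw [← h1, ← neg_zero, ← intervalIntegral.integral_comp_neg]
    simp [Odd.neg_pow (by decide : Odd 3)]
  rw [← intervalIntegral.integral_add_adjacent_intervals (hc.intervalIntegrable _ 0)
    (hc.intervalIntegrable 0 _), h1, h2]
  ring

theorem continuous_chart : Continuous chart := by
  refine continuous_pi fun i => ?_
  fin_cases i <;> simp [chart] <;> fun_prop

/-- A cone `C` in `ℝ⁴`, cut off at `q < 1` for a function `q` which is homogeneous of degree two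
and positive on `C`, has half the volume which is given in the affine chart by the density
`q⁻²`. -/
theorem volume_cone (C : Set (Fin 4 → ℝ)) (hC : MeasurableSet C) (q : (Fin 4 → ℝ) → ℝ)
    (hq : Measurable q) (hCs : ∀ (t : ℝ) (y), t ≠ 0 → (t • y ∈ C ↔ y ∈ C))
    (hqs : ∀ (t : ℝ) (y), q (t • y) = t ^ 2 * q y) (hpos : ∀ y ∈ C, 0 < q y) :
    2 * volume (C ∩ {y | q y < 1}) =
      ∫⁻ x in {x | chart x ∈ C}, ENNReal.ofReal (1 / q (chart x) ^ 2) := by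
  set K := C ∩ {y | q y < 1} with hK
  have hKm : MeasurableSet K := hC.inter (measurableSet_lt hq measurable_const)
  set F : (Fin 4 → ℝ) → ℝ≥0∞ := K.indicator 1 with hF
  have hFm : Measurable F := measurable_one.indicator hKm
  have e := (volume_preserving_piFinSuccAbove (fun _ : Fin 4 => ℝ) 0).symm
  have hcons : ∀ (t : ℝ) (x : Fin 3 → ℝ),
      (MeasurableEquiv.piFinSuccAbove (fun _ : Fin 4 => ℝ) 0).symm (t, t • x) = t • chart x := by
    intro t x
    ext i
    refine Fin.cases ?_ (fun i => ?_) i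
    · simp [MeasurableEquiv.piFinSuccAbove, chart, Fin.insertNthEquiv]
    · fin_cases i <;> simp [MeasurableEquiv.piFinSuccAbove, chart, Fin.insertNthEquiv] <;> rfl
  have hmeas : Measurable fun p : (Fin 3 → ℝ) × ℝ =>
      ENNReal.ofReal |p.2 ^ 3| * F (p.2 • chart p.1) :=
    (by fun_prop : Measurable fun p : (Fin 3 → ℝ) × ℝ => ENNReal.ofReal |p.2 ^ 3|).mul
      (hFm.comp (measurable_snd.smul (continuous_chart.measurable.comp measurable_fst)))
  have h1 : volume K = ∫⁻ x, ∫⁻ t : ℝ, ENNReal.ofReal |t ^ 3| * F (t • chart x) := by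
    rw [← lintegral_indicator_one hKm, ← hF, ← e.lintegral_comp hFm, Measure.volume_eq_prod,
      lintegral_prod (fun p => F ((MeasurableEquiv.piFinSuccAbove (fun _ : Fin 4 => ℝ) 0).symm p))
        (hFm.comp e.measurable).aemeasurable,
      lintegral_lintegral_swap (f := fun (x : Fin 3 → ℝ) (t : ℝ) =>
        ENNReal.ofReal |t ^ 3| * F (t • chart x)) hmeas.aemeasurable]
    apply lintegral_congr_ae
    have h0 : ∀ᵐ t : ℝ, t ≠ 0 := by simp [ae_iff]
    filter_upwards [h0] with t ht
    have hFt : Measurable fun x : Fin 3 → ℝ =>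
        F ((MeasurableEquiv.piFinSuccAbove (fun _ : Fin 4 => ℝ) 0).symm (t, x)) :=
      hFm.comp (e.measurable.comp measurable_prodMk_left)
    rw [lintegral_const_mul' _ _ ENNReal.ofReal_ne_top,
      lintegral_eq_abs_pow_mul_lintegral_comp_smul _ hFt ht]
    simp only [hcons]
  -- On the line through `chart x` the cut-off reads `|t| < s` with `s² = 1 / q (chart x)`, so the
  -- radial integral is `s⁴ / 2`.
  have h2 : ∀ x, 2 * ∫⁻ t : ℝ, ENNReal.ofReal |t ^ 3| * F (t • chart x) =
      {x | chart x ∈ C}.indicator (fun x => ENNReal.ofReal (1 / q (chart x) ^ 2)) x := by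
    intro x
    by_cases hx : chart x ∈ C
    · have hqx := hpos _ hx
      set s := (Real.sqrt (q (chart x)))⁻¹ with hs
      have hs0 : 0 < s := inv_pos.2 (Real.sqrt_pos.2 hqx)
      have hs2 : s ^ 2 = 1 / q (chart x) := by
        rw [hs, inv_pow, Real.sq_sqrt hqx.le, one_div]
      have : ∀ t : ℝ, ENNReal.ofReal |t ^ 3| * F (t • chart x) =
          (Ioo (-s) s).indicator (fun t => ENNReal.ofReal |t ^ 3|) t := by
        intro t
        rcases eq_or_ne t 0 with rfl | ht
        · simp [indicator_apply]
        · have : t • chart x ∈ K ↔ t ∈ Ioo (-s) s := by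
            rw [hK, mem_inter_iff, hCs t _ ht, mem_ofPred_eq, hqs, mem_Ioo, ← abs_lt,
              ← sq_lt_sq₀ (abs_nonneg t) hs0.le, sq_abs, hs2, lt_div_iff₀ hqx]
            tauto
          by_cases h : t ∈ Ioo (-s) s
          · simp [hF, indicator_of_mem h, indicator_of_mem (this.2 h)]
          · simp [hF, indicator_of_notMem h, indicator_of_notMem (mt this.1 h)]
      rw [lintegral_congr this, lintegral_indicator measurableSet_Ioo,
        lintegral_Ioo_abs_pow_three hs0.le, indicator_of_mem (by exact hx),
        ← ENNReal.ofReal_ofNat, ← ENNReal.ofReal_mul zero_le_two]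
      congr 1
      rw [show s ^ 4 = (s ^ 2) ^ 2 by ring, hs2]
      ring
    · rw [indicator_of_notMem (by exact hx)]
      have : ∀ t : ℝ, ENNReal.ofReal |t ^ 3| * F (t • chart x) = 0 := by
        intro t
        rcases eq_or_ne t 0 with rfl | ht
        · simp
        · rw [hF, indicator_of_notMem, mul_zero]
          exact fun h => hx ((hCs t _ ht).1 h.1)
      simp only [this, lintegral_zero, mul_zero]
  rw [h1, ← lintegral_const_mul' _ _ ENNReal.ofNat_ne_top, lintegral_congr h2,
    lintegral_indicator (show MeasurableSet {x | chart x ∈ C} from continuous_chart.measurable hC)]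

/-- Change of variables in the affine chart under the linear map with matrix rows `A i`. -/
theorem lintegral_chart_vecMul (A : Matrix (Fin 4) (Fin 4) ℝ) (hA : A.det ≠ 0)
    (C : Set (Fin 4 → ℝ)) (hC : MeasurableSet C) (q : (Fin 4 → ℝ) → ℝ)
    (hq : Measurable q) (hCs : ∀ (t : ℝ) (y), t ≠ 0 → (t • y ∈ C ↔ y ∈ C))
    (hqs : ∀ (t : ℝ) (y), q (t • y) = t ^ 2 * q y) (hpos : ∀ y ∈ C, 0 < q y) :
    ∫⁻ x in {x | chart x ∈ C}, ENNReal.ofReal (1 / q (chart x) ^ 2) =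
      ENNReal.ofReal |A.det| * ∫⁻ x in {x | chart x ᵥ* A ∈ C},
        ENNReal.ofReal (1 / q (chart x ᵥ* A) ^ 2) := by
  have hcont : Continuous fun b : Fin 4 → ℝ => b ᵥ* A := by fun_prop
  -- Both chart integrals are measures of cut-off cones, one the linear preimage of the other. This
  -- avoids the Jacobian of a projective map.
  have h := volume_cone ((fun b => b ᵥ* A) ⁻¹' C) (hcont.measurable hC) (fun b => q (b ᵥ* A))
    (hq.comp hcont.measurable) (fun t y ht => by simp [Matrix.smul_vecMul, hCs t _ ht])
    (fun t y => by simp [Matrix.smul_vecMul, hqs]) (fun y hy => hpos _ hy)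
  have h' := volume_cone C hC q hq hCs hqs hpos
  have hdet : LinearMap.det (Matrix.toLin' Aᵀ) = A.det := by
    rw [LinearMap.det_toLin', Matrix.det_transpose]
  have hpre := Measure.addHaar_preimage_linearMap (volume : Measure (Fin 4 → ℝ))
    (f := Matrix.toLin' Aᵀ) (by rwa [hdet]) (C ∩ {y | q y < 1})
  rw [hdet] at hpre
  have hset : (Matrix.toLin' Aᵀ) ⁻¹' (C ∩ {y | q y < 1}) =
      ((fun b => b ᵥ* A) ⁻¹' C) ∩ {b | q (b ᵥ* A) < 1} := by
    ext b
    simp [Matrix.mulVec_transpose]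
  rw [hset] at hpre
  have h'' : ∫⁻ x in {x | chart x ᵥ* A ∈ C}, ENNReal.ofReal (1 / q (chart x ᵥ* A) ^ 2) =
      2 * (ENNReal.ofReal |A.det⁻¹| * volume (C ∩ {y | q y < 1})) := by
    rw [← hpre, h]
    rfl
  rw [h'', ← h', mul_left_comm, ← mul_assoc (ENNReal.ofReal |A.det|),
    ← ENNReal.ofReal_mul (abs_nonneg _), ← abs_mul]
  simp [hA]

/-! ### The volume of a tetrahedron in coordinates given by its vertices -/

theorem mk_mem_Y {Λ : SignType} {v : Fin 4 → ℝ} (hv : v ≠ 0) :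
    Projectivization.mk ℝ v hv ∈ Y Λ ↔ form Λ v v < 0 := by
  unfold Y
  rw [mem_ofPred_eq, Projectivization.submodule_mk]
  constructor
  · exact fun h => h v (Submodule.mem_span_singleton_self v) hv
  · intro h y hy hy0
    obtain ⟨a, rfl⟩ := Submodule.mem_span_singleton.1 hy
    have ha : a ≠ 0 := by rintro rfl; simp at hy0
    have : form Λ (a • v) (a • v) = a ^ 2 * form Λ v v := by simp [form]; ring
    rw [this]
    exact mul_neg_of_pos_of_neg (by positivity) h

theorem volForm_chart (Λ : SignType) (x : Fin 3 → ℝ) :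
    |volForm Λ (chart x) ![0, 1, 0, 0] ![0, 0, 1, 0] ![0, 0, 0, 1]| =
      1 / (-form Λ (chart x) (chart x)) ^ 2 := by
  have : (Matrix.of ![chart x, ![0, 1, 0, 0], ![0, 0, 1, 0], ![0, 0, 0, 1]]).det = 1 := by
    simp [chart, Matrix.det_succ_row_zero, Fin.sum_univ_succ, Fin.succAbove]
  rw [volForm, this, abs_of_nonneg (by positivity), neg_sq]

theorem form_smul_smul (Λ : SignType) (a b : ℝ) (x y : Fin 4 → ℝ) :
    form Λ (a • x) (b • y) = a * b * form Λ x y := by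
  simp [form]; ring

theorem continuous_form_self (Λ : SignType) : Continuous fun y => form Λ y y := by
  unfold form; fun_prop

/-- Membership in an ideal tetrahedron in terms of coordinates with respect to rescaled
vertices. -/
theorem IdealTetrahedron.mk_mem_carrier_iff {Λ : SignType} (T : IdealTetrahedron Λ)
    (σ : Equiv.Perm (Fin 4)) (k : Fin 4 → ℝ) (hk : ∀ i j, 0 < k i * k j)
    (c y : Fin 4 → ℝ) (hy : y ≠ 0) (hcy : y = ∑ i, c i • k i • T.lift (σ i)) :
    Projectivization.mk ℝ y hy ∈ T.carrier ↔
      form Λ y y < 0 ∧ ((∀ i, 0 ≤ c i) ∨ ∀ i, c i ≤ 0) := by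
  have hk0 : ∀ i, k i ≠ 0 := fun i h => by simpa [h] using hk i i
  have hsgn : (∀ i, 0 < k i) ∨ ∀ i, k i < 0 := by
    rcases lt_or_gt_of_ne (hk0 0) with h | h
    · exact Or.inr fun i => by
        by_contra! h'
        nlinarith [hk 0 i]
    · exact Or.inl fun i => (pos_iff_pos_of_mul_pos (hk 0 i)).1 h
  have hexp : y = ∑ i, (c (σ.symm i) * k (σ.symm i)) • T.lift i := by
    rw [hcy, ← Equiv.sum_comp σ (fun i => (c (σ.symm i) * k (σ.symm i)) • T.lift i)]
    simp [smul_smul]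
  unfold IdealTetrahedron.carrier
  rw [mem_ofPred_eq, mk_mem_Y]
  refine and_congr_right fun _ => ⟨?_, ?_⟩
  · rintro ⟨b, h, hb, heq⟩
    obtain ⟨a, ha⟩ := (Projectivization.mk_eq_mk_iff' ℝ _ _ hy h).1 heq
    -- Representatives of one point differ by a factor `a`, and independence lets coordinates be
    -- compared. The signs of `a` and of `k` then decide between the two alternatives.
    have hco : ∀ i, a * b i = c (σ.symm i) * k (σ.symm i) := by
      have : ∑ i, (a * b i - c (σ.symm i) * k (σ.symm i)) • T.lift i = 0 := by
        simp only [sub_smul, Finset.sum_sub_distrib, mul_smul a, ← Finset.smul_sum]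
        rw [ha, ← hexp, sub_self]
      intro i
      exact sub_eq_zero.1 (Fintype.linearIndependent_iff.1 T.indep _ this i)
    have hc : ∀ i, c i = a * b (σ i) / k i := fun i => by
      rw [eq_div_iff (hk0 i), hco]; simp
    have hmain : ∀ i, (0 ≤ a / k i → 0 ≤ c i) ∧ (a / k i ≤ 0 → c i ≤ 0) := fun i => by
      rw [hc, mul_div_right_comm]
      exact ⟨fun h => mul_nonneg h (hb _), fun h => mul_nonpos_of_nonpos_of_nonneg h (hb _)⟩
    rcases le_total 0 a with ha | ha <;> rcases hsgn with hs | hs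
    · exact Or.inl fun i => (hmain i).1 (div_nonneg ha (hs i).le)
    · exact Or.inr fun i => (hmain i).2 (div_nonpos_of_nonneg_of_nonpos ha (hs i).le)
    · exact Or.inr fun i => (hmain i).2 (div_nonpos_of_nonpos_of_nonneg ha (hs i).le)
    · exact Or.inl fun i => (hmain i).1 (div_nonneg_of_nonpos ha (hs i).le)
  · intro h
    have hck : (∀ i, 0 ≤ c (σ.symm i) * k (σ.symm i)) ∨ ∀ i, c (σ.symm i) * k (σ.symm i) ≤ 0 := by
      rcases h with h | h <;> rcases hsgn with hs | hs
      · exact Or.inl fun i => mul_nonneg (h _) (hs _).le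
      · exact Or.inr fun i => mul_nonpos_of_nonneg_of_nonpos (h _) (hs _).le
      · exact Or.inr fun i => mul_nonpos_of_nonpos_of_nonneg (h _) (hs _).le
      · exact Or.inl fun i => mul_nonneg_of_nonpos_of_nonpos (h _) (hs _).le
    rcases hck with hck | hck
    · exact ⟨fun i => c (σ.symm i) * k (σ.symm i), hexp ▸ hy, hck, by congr 1⟩
    · have hneg : ∑ i, (-(c (σ.symm i) * k (σ.symm i))) • T.lift i = -y := by
        rw [hexp]; simp
      refine ⟨fun i => -(c (σ.symm i) * k (σ.symm i)), by rw [hneg]; exact neg_ne_zero.2 hy,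
        fun i => neg_nonneg.2 (hck i), ?_⟩
      rw [Projectivization.mk_eq_mk_iff']
      exact ⟨-1, by rw [hneg]; simp⟩

/-- The volume of an ideal tetrahedron as an integral over the positive octant. -/
theorem IdealTetrahedron.vol_carrier {Λ : SignType} (T : IdealTetrahedron Λ)
    (σ : Equiv.Perm (Fin 4)) (k : Fin 4 → ℝ) (hk : ∀ i j, 0 < k i * k j)
    (A : Matrix (Fin 4) (Fin 4) ℝ) (hAk : ∀ i, A i = k i • T.lift (σ i)) (hA : A.det ≠ 0)
    (q : (Fin 4 → ℝ) → ℝ) (hq : ∀ b, form Λ (b ᵥ* A) (b ᵥ* A) = -q b)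
    (hqpos : ∀ x : Fin 3 → ℝ, (∀ i, 0 < x i) → 0 < q (chart x)) :
    vol Λ T.carrier = ENNReal.ofReal |A.det| *
      ∫⁻ x in {x : Fin 3 → ℝ | ∀ i, 0 < x i}, ENNReal.ofReal (1 / q (chart x) ^ 2) := by
  have hu : IsUnit A.det := isUnit_iff_ne_zero.2 hA
  set C : Set (Fin 4 → ℝ) := {y | form Λ y y < 0 ∧ ((∀ i, 0 ≤ (y ᵥ* A⁻¹) i) ∨
    ∀ i, (y ᵥ* A⁻¹) i ≤ 0)} with hC
  have hcoord : ∀ i, Measurable fun y : Fin 4 → ℝ => (y ᵥ* A⁻¹) i := fun i =>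
    (by fun_prop : Continuous fun y : Fin 4 → ℝ => (y ᵥ* A⁻¹) i).measurable
  have hCm : MeasurableSet C := by
    have h1 : MeasurableSet {y : Fin 4 → ℝ | ∀ i, 0 ≤ (y ᵥ* A⁻¹) i} := by
      simp only [ofPred_forall]
      exact MeasurableSet.iInter fun i => measurableSet_le measurable_const (hcoord i)
    have h2 : MeasurableSet {y : Fin 4 → ℝ | ∀ i, (y ᵥ* A⁻¹) i ≤ 0} := by
      simp only [ofPred_forall]
      exact MeasurableSet.iInter fun i => measurableSet_le (hcoord i) measurable_const
    exact (measurableSet_lt (continuous_form_self Λ).measurable measurable_const).inter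
      (h1.union h2)
  have hCsub : ∀ (t : ℝ) (y), t ≠ 0 → y ∈ C → t • y ∈ C := by
    intro t y ht hy
    refine ⟨?_, ?_⟩
    · rw [form_smul_smul]
      exact mul_neg_of_pos_of_neg (mul_self_pos.2 ht) hy.1
    · simp only [Matrix.smul_vecMul, Pi.smul_apply, smul_eq_mul]
      rcases lt_or_gt_of_ne ht with ht | ht
      · exact hy.2.symm.imp (fun h i => mul_nonneg_of_nonpos_of_nonpos ht.le (h i))
          (fun h i => mul_nonpos_of_nonpos_of_nonneg ht.le (h i))
      · exact hy.2.imp (fun h i => mul_nonneg ht.le (h i))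
          (fun h i => mul_nonpos_of_nonneg_of_nonpos ht.le (h i))
  have hCs : ∀ (t : ℝ) (y), t ≠ 0 → (t • y ∈ C ↔ y ∈ C) := by
    refine fun t y ht => ⟨fun h => ?_, hCsub t y ht⟩
    simpa [smul_smul, ht] using hCsub t⁻¹ _ (inv_ne_zero ht) h
  have hset : {x : Fin 3 → ℝ | Projectivization.mk ℝ (chart x) (chart_ne_zero x) ∈
      T.carrier ∩ Y Λ} = {x | chart x ∈ C} := by
    ext x
    have hmem : chart x = ∑ i, (chart x ᵥ* A⁻¹) i • k i • T.lift (σ i) := by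
      have : chart x = (chart x ᵥ* A⁻¹) ᵥ* A := by
        rw [Matrix.vecMul_vecMul, Matrix.nonsing_inv_mul _ hu, Matrix.vecMul_one]
      conv_lhs => rw [this, Matrix.vecMul_eq_sum]
      simp only [hAk]
    have h := T.mk_mem_carrier_iff σ k hk _ _ (chart_ne_zero x) hmem
    have hY := mk_mem_Y (Λ := Λ) (chart_ne_zero x)
    rw [mem_ofPred_eq, mem_inter_iff, h, hY]
    exact and_iff_left_of_imp fun h => h.1
  -- The sets differ only on coordinate planes: the first coordinate of `chart x` is 1, which
  -- excludes the nonpositive alternative.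
  have hae : ({x | chart x ᵥ* A ∈ C} : Set (Fin 3 → ℝ)) =ᵐ[volume]
      ({x : Fin 3 → ℝ | ∀ i, 0 < x i} : Set (Fin 3 → ℝ)) := by
    have h0 : ∀ᵐ x : Fin 3 → ℝ, ∀ i, x i ≠ 0 :=
      ae_all_iff.2 fun i => Measure.ae_eval_ne (μ := fun _ : Fin 3 => volume) i 0
    refine eventuallyEq_set.2 ?_
    filter_upwards [h0] with x hx
    have hinv : (chart x ᵥ* A) ᵥ* A⁻¹ = chart x := by
      rw [Matrix.vecMul_vecMul, Matrix.mul_nonsing_inv _ hu, Matrix.vecMul_one]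
    simp only [hC, mem_ofPred_eq, hinv, hq]
    constructor
    · rintro ⟨-, h | h⟩ i
      · have h1 := h i.succ
        refine lt_of_le_of_ne ?_ (hx i).symm
        fin_cases i <;> simpa [chart] using h1
      · have := h 0
        simp [chart] at this
        linarith
    · intro h
      refine ⟨by linarith [hqpos x h], Or.inl fun i => ?_⟩
      have h0 := (h 0).le
      have h1 := (h 1).le
      have h2 := (h 2).le
      fin_cases i <;> simp [chart, h0, h1, h2]
  unfold vol
  rw [hset]
  simp only [volForm_chart]
  rw [lintegral_chart_vecMul A hA C hCm (fun y => -form Λ y y) (continuous_form_self Λ).neg.measurable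
    hCs (fun t y => by rw [form_smul_smul]; ring) (fun y hy => by linarith [hy.1]),
    setLIntegral_congr hae]
  simp only [hq, neg_neg]

end GenIdeal

end

noncomputable section

namespace GenIdeal

open MeasureTheory Set Filter Topology

/-! ### Evaluation of the volume integral -/

/-- The order suits `angleForm`: `w` and then `u` are integrated in closed form, and the middle
coordinate `t` is left for the substitution. -/
theorem lintegral_pi_fin_three (ν : Measure ℝ) [SigmaFinite ν] (f : (Fin 3 → ℝ) → ℝ≥0∞)
    (hf : Measurable f) :
    ∫⁻ x, f x ∂(Measure.pi fun _ => ν) = ∫⁻ t, ∫⁻ u, ∫⁻ w, f ![u, t, w] ∂ν ∂ν ∂ν := by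
  have e := (measurePreserving_piFinSuccAbove (fun _ : Fin 3 => ν) 1).symm
  have e2 := (measurePreserving_finTwoArrow_vec ν ν).symm
  have hv : (fun _ : Fin 2 => ν) = ![ν, ν] := by
    ext i
    fin_cases i <;> rfl
  rw [← hv] at e2
  rw [← e.lintegral_comp hf, lintegral_prod
    (fun p => f ((MeasurableEquiv.piFinSuccAbove (fun _ : Fin 3 => ℝ) 1).symm p))
    (hf.comp e.measurable).aemeasurable]
  refine lintegral_congr fun t => ?_
  have hft : Measurable fun y =>
      f ((MeasurableEquiv.piFinSuccAbove (fun _ : Fin 3 => ℝ) 1).symm (t, y)) :=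
    hf.comp (e.measurable.comp measurable_prodMk_left)
  rw [← e2.lintegral_comp hft, lintegral_prod (fun p =>
    f ((MeasurableEquiv.piFinSuccAbove (fun _ : Fin 3 => ℝ) 1).symm
      (t, MeasurableEquiv.finTwoArrow.symm p))) (hft.comp e2.measurable).aemeasurable]
  refine lintegral_congr fun u => lintegral_congr fun w => congrArg f ?_
  ext i
  fin_cases i <;> rfl

theorem lintegral_Ioi_of_hasDerivAt {F f : ℝ → ℝ} {l : ℝ}
    (hF : ∀ x, 0 ≤ x → HasDerivAt F (f x) x) (hf : ∀ x, 0 < x → 0 ≤ f x)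
    (hl : Tendsto F atTop (𝓝 l)) :
    ∫⁻ x in Ioi 0, ENNReal.ofReal (f x) = ENNReal.ofReal (l - F 0) := by
  rw [← integral_Ioi_of_hasDerivAt_of_nonneg' (fun x hx => hF x hx) (fun x hx => hf x hx) hl,
    ofReal_integral_eq_lintegral_ofReal
      (integrableOn_Ioi_deriv_of_nonneg' (fun x hx => hF x hx) (fun x hx => hf x hx) hl)]
  filter_upwards [ae_restrict_mem measurableSet_Ioi] with x hx using hf x hx

theorem lintegral_one_div_sq {p r : ℝ} (hp : 0 < p) (hr : 0 < r) :
    ∫⁻ w in Ioi 0, ENNReal.ofReal (1 / (w * p + r) ^ 2) = ENNReal.ofReal (1 / (p * r)) := by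
  rw [lintegral_Ioi_of_hasDerivAt (F := fun w => -(1 / p) * (w * p + r)⁻¹) (l := -(1 / p) * 0)]
  · congr 1
    field_simp
    ring
  · intro w hw
    have h0 : w * p + r ≠ 0 := by positivity
    have h : HasDerivAt (fun w => w * p + r) p w := by
      simpa using ((hasDerivAt_id w).mul_const p).add_const r
    refine ((h.inv h0).const_mul (-(1 / p))).congr_deriv ?_
    field_simp
  · intro w _
    positivity
  · refine Tendsto.const_mul _ (tendsto_inv_atTop_zero.comp ?_)
    exact tendsto_atTop_add_const_right _ _ (tendsto_id.atTop_mul_const hp)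

/-- Partial fractions; `k * p - r` is the determinant of the two linear factors. -/
theorem lintegral_one_div_mul {p k r : ℝ} (hp : 0 < p) (hk : 0 < k) (hr : 0 < r)
    (hD : 0 < k * p - r) :
    ∫⁻ u in Ioi 0, ENNReal.ofReal (1 / ((u + p) * (k * u + r))) =
      ENNReal.ofReal (Real.log (k * p / r) / (k * p - r)) := by
  rw [lintegral_Ioi_of_hasDerivAt
    (F := fun u => (Real.log (k * u + r) - Real.log (u + p)) / (k * p - r))
    (l := Real.log k / (k * p - r))]
  · congr 1
    rw [Real.log_div (by positivity) hr.ne', Real.log_mul hk.ne' hp.ne']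
    simp
    ring
  · intro u hu
    have h1 : 0 < k * u + r := by positivity
    have h2 : 0 < u + p := by positivity
    have d1 : HasDerivAt (fun u => k * u + r) k u := by
      simpa using ((hasDerivAt_id u).const_mul k).add_const r
    have d2 : HasDerivAt (fun u => u + p) 1 u := (hasDerivAt_id u).add_const p
    refine (((d1.log h1.ne').sub (d2.log h2.ne')).div_const (k * p - r)).congr_deriv ?_
    have h3 := hD.ne'
    field_simp
    ring
  · intro u hu
    positivity
  · refine Tendsto.div_const ?_ _
    have h1 : Tendsto (fun u : ℝ => (k * u + r) / (u + p)) atTop (𝓝 k) := by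
      have h2 : Tendsto (fun u : ℝ => k + (r - k * p) * (u + p)⁻¹) atTop
          (𝓝 (k + (r - k * p) * 0)) :=
        tendsto_const_nhds.add (tendsto_const_nhds.mul (tendsto_inv_atTop_zero.comp
          (tendsto_atTop_add_const_right _ _ tendsto_id)))
      rw [mul_zero, add_zero] at h2
      refine h2.congr' ?_
      filter_upwards [eventually_gt_atTop 0] with u hu
      have : u + p ≠ 0 := by positivity
      field_simp
      ring
    refine ((Real.continuousAt_log hk.ne').tendsto.comp h1).congr' ?_
    filter_upwards [eventually_gt_atTop 0] with u hu
    rw [Function.comp_apply, Real.log_div (by positivity) (by positivity)]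

/-- Negative of the ambient quadratic form, in coordinates with respect to suitably scaled lifts of
the vertices of a tetrahedron with generalized dihedral angles `α, β, -(α + β)`. -/
def angleForm (Λ : SignType) (α β : ℝ) (b : Fin 4 → ℝ) : ℝ :=
  b 3 * (b 0 + b 1 + b 2) + genSin Λ (α + β) ^ 2 * (b 0 * b 1) + genSin Λ β ^ 2 * (b 0 * b 2) +
    genSin Λ α ^ 2 * (b 1 * b 2)

/-! ### The substitution by an angle and the reduction to log-sine integrals -/

section AngleParam

variable {Λ : SignType} {α β : ℝ}

/-- The parametrization of the half line which rationalizes the volume integral. -/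
def angleParam (Λ : SignType) (α β φ : ℝ) : ℝ :=
  genSin Λ (α + β) * genSin Λ (β - φ) / (genSin Λ α * genSin Λ φ)

theorem hasDerivAt_angleParam (hα : genSin Λ α ≠ 0) {φ : ℝ} (hφ : genSin Λ φ ≠ 0) :
    HasDerivAt (angleParam Λ α β)
      (-(genSin Λ (α + β) * genSin Λ β / (genSin Λ α * genSin Λ φ ^ 2))) φ := by
  have h1 : HasDerivAt (fun φ => genSin Λ (β - φ)) (-genCos Λ (β - φ)) φ :=
    ((hasDerivAt_genSin Λ (β - φ)).comp φ ((hasDerivAt_id φ).const_sub β)).congr_deriv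
      (by ring)
  refine ((h1.const_mul (genSin Λ (α + β))).div ((hasDerivAt_genSin Λ φ).const_mul (genSin Λ α))
    (mul_ne_zero hα hφ)).congr_deriv ?_
  -- The numerator of the quotient rule is the addition theorem for `(β - φ) + φ`.
  have h2 : genSin Λ β = genSin Λ (β - φ) * genCos Λ φ + genCos Λ (β - φ) * genSin Λ φ := by
    rw [← genSin_add, sub_add_cancel]
  rw [h2]
  field_simp
  ring

theorem angleParam_image (hα : 0 < α) (hβ : 0 < β)
    (hαβ : Λ = 1 → α + β < Real.pi) : angleParam Λ α β '' Ioo 0 β = Ioi 0 := by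
  have ha : 0 < genSin Λ α := genSin_pos Λ hα fun h => by linarith [hαβ h]
  have hb : 0 < genSin Λ β := genSin_pos Λ hβ fun h => by linarith [hαβ h]
  have hg : 0 < genSin Λ (α + β) := genSin_pos Λ (by linarith) hαβ
  ext t
  constructor
  · rintro ⟨φ, hφ, rfl⟩
    have h1 : 0 < genSin Λ φ := genSin_pos Λ hφ.1 fun h => by linarith [hαβ h, hφ.2]
    have h2 : 0 < genSin Λ (β - φ) :=
      genSin_pos Λ (by linarith [hφ.2]) fun h => by linarith [hαβ h, hφ.1]
    exact mem_Ioi.2 (by unfold angleParam; positivity)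
  · intro ht
    rw [mem_Ioi] at ht
    -- Clearing the denominator removes the pole at `φ = 0`, so the intermediate value theorem
    -- applies on the closed interval.
    have hc : ContinuousOn (fun φ => genSin Λ (α + β) * genSin Λ (β - φ) -
        genSin Λ α * t * genSin Λ φ) (Icc 0 β) := by fun_prop
    obtain ⟨φ, hφ, h0⟩ := intermediate_value_Ioo' hβ.le hc
      (show (0 : ℝ) ∈ _ by simp; constructor <;> positivity)
    refine ⟨φ, hφ, ?_⟩
    have h1 : 0 < genSin Λ φ := genSin_pos Λ hφ.1 fun h => by linarith [hαβ h, hφ.2]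
    unfold angleParam
    rw [div_eq_iff (by positivity)]
    linarith

theorem angleParam_injOn (hα : 0 < α) (hβ : 0 < β)
    (hαβ : Λ = 1 → α + β < Real.pi) : InjOn (angleParam Λ α β) (Ioo 0 β) := by
  have ha : 0 < genSin Λ α := genSin_pos Λ hα fun h => by linarith [hαβ h]
  have hb : 0 < genSin Λ β := genSin_pos Λ hβ fun h => by linarith [hαβ h]
  have hg : 0 < genSin Λ (α + β) := genSin_pos Λ (by linarith) hαβ
  have hpos : ∀ φ ∈ Ioo 0 β, 0 < genSin Λ φ := fun φ hφ =>
    genSin_pos Λ hφ.1 fun h => by linarith [hαβ h, hφ.2]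
  refine (strictAntiOn_of_deriv_neg (convex_Ioo 0 β) (fun φ hφ =>
    (hasDerivAt_angleParam ha.ne' (hpos φ hφ).ne').continuousAt.continuousWithinAt) ?_).injOn
  intro φ hφ
  rw [interior_Ioo] at hφ
  rw [(hasDerivAt_angleParam ha.ne' (hpos φ hφ).ne').deriv]
  have := hpos φ hφ
  exact neg_neg_of_pos (by positivity)

/-- Together with `angleParam_mul_sq_add`, this factors `p = t + 1` and `k` into sines, so that the
logarithm of `k p / r` splits. -/
theorem angleParam_add_one (hα : genSin Λ α ≠ 0) {φ : ℝ} (hφ : genSin Λ φ ≠ 0) :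
    angleParam Λ α β φ + 1 =
      genSin Λ β * genSin Λ (α + β - φ) / (genSin Λ α * genSin Λ φ) := by
  unfold angleParam
  field_simp
  have h1 := genCos_sq Λ β
  rw [genSin_sub, genSin_sub, genSin_add, genCos_add]
  linear_combination (-genSin Λ α * genSin Λ φ) * h1

theorem angleParam_mul_sq_add (hα : genSin Λ α ≠ 0) {φ : ℝ} (hφ : genSin Λ φ ≠ 0) :
    genSin Λ α ^ 2 * angleParam Λ α β φ + genSin Λ (α + β) ^ 2 =
      genSin Λ (α + β) * genSin Λ β * genSin Λ (α + φ) / genSin Λ φ := by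
  unfold angleParam
  field_simp
  rw [genSin_sub, genSin_add Λ α β, genSin_add Λ α φ]
  ring

/-- The integrand of the volume formula. -/
def logSinRatio (Λ : SignType) (α β φ : ℝ) : ℝ :=
  Real.log |2 * genSin Λ (α + β - φ)| + Real.log |2 * genSin Λ (α + φ)| -
    Real.log |2 * genSin Λ φ| - Real.log |2 * genSin Λ (β - φ)|

theorem lintegral_angleParam_slice (hα : 0 < α) (hβ : 0 < β)
    (hαβ : Λ = 1 → α + β < Real.pi)
    {φ : ℝ} (hφ : φ ∈ Ioo 0 β) :
    0 ≤ logSinRatio Λ α β φ ∧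
    ENNReal.ofReal (genSin Λ α * genSin Λ β * genSin Λ (α + β) / 2) *
      (ENNReal.ofReal |-(genSin Λ (α + β) * genSin Λ β / (genSin Λ α * genSin Λ φ ^ 2))| *
        ∫⁻ u in Ioi 0, ∫⁻ w in Ioi 0,
          ENNReal.ofReal (1 / angleForm Λ α β (chart ![u, angleParam Λ α β φ, w]) ^ 2)) =
      ENNReal.ofReal (1 / 2 * logSinRatio Λ α β φ) := by
  have ha : 0 < genSin Λ α := genSin_pos Λ hα fun h => by linarith [hαβ h]
  have hb : 0 < genSin Λ β := genSin_pos Λ hβ fun h => by linarith [hαβ h]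
  have hg : 0 < genSin Λ (α + β) := genSin_pos Λ (by linarith) hαβ
  have h1 : 0 < genSin Λ φ := genSin_pos Λ hφ.1 fun h => by linarith [hαβ h, hφ.2]
  have h2 : 0 < genSin Λ (β - φ) :=
    genSin_pos Λ (by linarith [hφ.2]) fun h => by linarith [hαβ h, hφ.1]
  have h3 : 0 < genSin Λ (α + φ) :=
    genSin_pos Λ (by linarith [hφ.1]) fun h => by linarith [hαβ h, hφ.2]
  have h4 : 0 < genSin Λ (α + β - φ) :=
    genSin_pos Λ (by linarith [hφ.2]) fun h => by linarith [hαβ h, hφ.1]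
  have ht : 0 < angleParam Λ α β φ := by unfold angleParam; positivity
  have e1 := angleParam_add_one (β := β) ha.ne' h1.ne'
  have e2 := angleParam_mul_sq_add (β := β) ha.ne' h1.ne'
  have e3 : genSin Λ α * genSin Λ φ * angleParam Λ α β φ =
      genSin Λ (α + β) * genSin Λ (β - φ) := by
    unfold angleParam; field_simp
  set t := angleParam Λ α β φ with htdef
  -- By `e5` the left side is `(s(α) t + s(α+β) c(β))² + Λ s(α+β)² s(β)²`. By `e4` the first bracket
  -- is `s(α+β) s(β) c(φ) / s(φ)`, and `c² + Λ s² = 1` finishes.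
  have hprod : (genSin Λ α ^ 2 * t + genSin Λ (α + β) ^ 2) * (t + 1) - genSin Λ β ^ 2 * t =
      genSin Λ (α + β) ^ 2 * genSin Λ β ^ 2 / genSin Λ φ ^ 2 := by
    have h := genCos_sq Λ β
    have e4 : genSin Λ φ * (genSin Λ α * t + genSin Λ (α + β) * genCos Λ β) =
        genSin Λ (α + β) * genSin Λ β * genCos Λ φ := by
      rw [genSin_sub] at e3
      linear_combination e3
    have h' := genCos_sq Λ φ
    -- The law of cosines, with side lengths replaced by sines.
    have e5 : genSin Λ β ^ 2 = genSin Λ α ^ 2 + genSin Λ (α + β) ^ 2 -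
        2 * genSin Λ α * genSin Λ (α + β) * genCos Λ β := by
      rw [genSin_add]
      have h'' := genCos_sq Λ α
      linear_combination (genSin Λ α ^ 2) * h - (genSin Λ β ^ 2) * h''
    rw [eq_div_iff (by positivity)]
    have e6 := congrArg (· ^ 2) e4
    linear_combination e6 - (t * genSin Λ φ ^ 2) * e5 - (genSin Λ φ ^ 2 * genSin Λ (α + β) ^ 2) * h +
      (genSin Λ (α + β) ^ 2 * genSin Λ β ^ 2) * h'
  have hD : 0 < (genSin Λ α ^ 2 * t + genSin Λ (α + β) ^ 2) * (t + 1) - genSin Λ β ^ 2 * t := by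
    rw [hprod]; positivity
  have hratio : (genSin Λ α ^ 2 * t + genSin Λ (α + β) ^ 2) * (t + 1) / (genSin Λ β ^ 2 * t) =
      (genSin Λ (α + β - φ) * genSin Λ (α + φ)) / (genSin Λ φ * genSin Λ (β - φ)) := by
    rw [e1, e2, div_eq_div_iff (by positivity) (by positivity)]
    field_simp
    linear_combination (-1 : ℝ) * e3
  have hlog : Real.log ((genSin Λ α ^ 2 * t + genSin Λ (α + β) ^ 2) * (t + 1) /
      (genSin Λ β ^ 2 * t)) = logSinRatio Λ α β φ := by
    rw [hratio, logSinRatio, Real.log_div (by positivity) (by positivity),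
      Real.log_mul h4.ne' h3.ne', Real.log_mul h1.ne' h2.ne']
    simp only [abs_mul, abs_of_pos h1, abs_of_pos h2, abs_of_pos h3, abs_of_pos h4, abs_two,
      Real.log_mul two_ne_zero h1.ne', Real.log_mul two_ne_zero h2.ne',
      Real.log_mul two_ne_zero h3.ne', Real.log_mul two_ne_zero h4.ne']
    ring
  have hnn : 0 ≤ logSinRatio Λ α β φ := by
    rw [← hlog]
    refine Real.log_nonneg ?_
    rw [one_le_div (by positivity)]
    linarith
  refine ⟨hnn, ?_⟩
  have hin : ∫⁻ u in Ioi 0, ∫⁻ w in Ioi 0,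
      ENNReal.ofReal (1 / angleForm Λ α β (chart ![u, t, w]) ^ 2) =
      ∫⁻ u in Ioi 0, ENNReal.ofReal (1 / ((u + (t + 1)) *
        ((genSin Λ α ^ 2 * t + genSin Λ (α + β) ^ 2) * u + genSin Λ β ^ 2 * t))) := by
    refine setLIntegral_congr_fun measurableSet_Ioi fun u hu => ?_
    rw [mem_Ioi] at hu
    have := lintegral_one_div_sq (p := u + (t + 1))
      (r := (genSin Λ α ^ 2 * t + genSin Λ (α + β) ^ 2) * u + genSin Λ β ^ 2 * t)
      (by positivity) (by positivity)
    rw [← this]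
    refine lintegral_congr fun w => ?_
    congr 3
    simp [angleForm, chart]
    ring
  rw [hin, lintegral_one_div_mul (by positivity) (by positivity) (by positivity) hD, hlog, hprod,
    abs_neg, abs_of_pos (by positivity), ← ENNReal.ofReal_mul (by positivity),
    ← ENNReal.ofReal_mul (by positivity)]
  congr 1
  field_simp

theorem intervalIntegrable_logSinRatio (Λ : SignType) (α β a b : ℝ) :
    IntervalIntegrable (logSinRatio Λ α β) volume a b := by
  have h := fun a b => intervalIntegrable_log_genSin Λ a b
  refine (((?_ : IntervalIntegrable _ volume a b).add ?_).sub ?_).sub ?_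
  · simpa using (h (α + β - a) (α + β - b)).comp_sub_left (α + β)
  · simpa [add_comm] using (h (a + α) (b + α)).comp_add_right α
  · exact h a b
  · simpa using (h (β - a) (β - b)).comp_sub_left β

/-- The first two terms both integrate to `L(α+β) - L(α)` and the last two both to `L(β)`, where `L`
is `logSinInt`; this absorbs the factor `1 / 2`. -/
theorem integral_logSinRatio (Λ : SignType) (α β : ℝ) :
    ∫ φ in (0 : ℝ)..β, 1 / 2 * logSinRatio Λ α β φ = clausenSum Λ α β (-(α + β)) := by
  have h := fun a b => intervalIntegrable_log_genSin Λ a b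
  have i1 : IntervalIntegrable (fun φ => Real.log |2 * genSin Λ (α + β - φ)|) volume 0 β := by
    simpa using (h (α + β - 0) (α + β - β)).comp_sub_left (α + β)
  have i2 : IntervalIntegrable (fun φ => Real.log |2 * genSin Λ (α + φ)|) volume 0 β := by
    simpa [add_comm] using (h (0 + α) (β + α)).comp_add_right α
  have i4 : IntervalIntegrable (fun φ => Real.log |2 * genSin Λ (β - φ)|) volume 0 β := by
    simpa using (h (β - 0) (β - β)).comp_sub_left β
  rw [intervalIntegral.integral_const_mul]
  unfold logSinRatio
  rw [intervalIntegral.integral_sub ((i1.add i2).sub (h 0 β)) i4,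
    intervalIntegral.integral_sub (i1.add i2) (h 0 β), intervalIntegral.integral_add i1 i2,
    intervalIntegral.integral_comp_sub_left (fun φ => Real.log |2 * genSin Λ φ|),
    intervalIntegral.integral_comp_sub_left (fun φ => Real.log |2 * genSin Λ φ|),
    intervalIntegral.integral_comp_add_left (fun φ => Real.log |2 * genSin Λ φ|)]
  simp only [integral_log_genSin, clausenSum_eq, logSinInt_neg]
  simp [logSinInt]
  ring

/-- The volume integral of a tetrahedron with angles `α, β > 0`. -/
theorem lintegral_angleForm (hα : 0 < α) (hβ : 0 < β)
    (hαβ : Λ = 1 → α + β < Real.pi) :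
    ENNReal.ofReal (genSin Λ α * genSin Λ β * genSin Λ (α + β) / 2) *
      ∫⁻ x in {x : Fin 3 → ℝ | ∀ i, 0 < x i},
        ENNReal.ofReal (1 / angleForm Λ α β (chart x) ^ 2) =
      ENNReal.ofReal (clausenSum Λ α β (-(α + β))) ∧ 0 ≤ clausenSum Λ α β (-(α + β)) := by
  have ha : 0 < genSin Λ α := genSin_pos Λ hα fun h => by linarith [hαβ h]
  have hpos : ∀ φ ∈ Ioo 0 β, 0 < genSin Λ φ := fun φ hφ =>
    genSin_pos Λ hφ.1 fun h => by linarith [hαβ h, hφ.2]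
  have hset : {x : Fin 3 → ℝ | ∀ i, 0 < x i} = univ.pi fun _ => Ioi 0 := by
    ext x; simp
  have hm : Measurable fun x : Fin 3 → ℝ =>
      ENNReal.ofReal (1 / angleForm Λ α β (chart x) ^ 2) := by
    have : Continuous fun x : Fin 3 → ℝ => angleForm Λ α β (chart x) := by
      have := continuous_chart
      unfold angleForm
      fun_prop
    exact (measurable_const.div (this.measurable.pow_const 2)).ennreal_ofReal
  have hnn : ∀ φ ∈ Ioo 0 β, 0 ≤ 1 / 2 * logSinRatio Λ α β φ := fun φ hφ => by
    have := (lintegral_angleParam_slice hα hβ hαβ hφ).1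
    positivity
  have hint : ∫ φ in Ioo 0 β, 1 / 2 * logSinRatio Λ α β φ = clausenSum Λ α β (-(α + β)) := by
    rw [← integral_Ioc_eq_integral_Ioo, ← intervalIntegral.integral_of_le hβ.le,
      integral_logSinRatio]
  refine ⟨?_, hint ▸ setIntegral_nonneg measurableSet_Ioo hnn⟩
  rw [hset, volume_pi, Measure.restrict_pi_pi, lintegral_pi_fin_three _ _ hm,
    ← angleParam_image hα hβ hαβ, lintegral_image_eq_lintegral_abs_deriv_mul measurableSet_Ioo
      (fun φ hφ => (hasDerivAt_angleParam ha.ne' (hpos φ hφ).ne').hasDerivWithinAt)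
      (angleParam_injOn hα hβ hαβ), angleParam_image hα hβ hαβ,
    ← lintegral_const_mul' _ _ ENNReal.ofReal_ne_top,
    setLIntegral_congr_fun measurableSet_Ioo
      fun φ hφ => (lintegral_angleParam_slice hα hβ hαβ hφ).2, ← hint,
    ofReal_integral_eq_lintegral_ofReal]
  · exact ((intervalIntegrable_iff_integrableOn_Ioo_of_le hβ.le).1
      (intervalIntegrable_logSinRatio Λ α β 0 β)).const_mul _
  · filter_upwards [ae_restrict_mem measurableSet_Ioo] with φ hφ using hnn φ hφ

end AngleParam

end GenIdeal

end

noncomputable section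

namespace GenIdeal

/-! ### The action on hermitian matrices -/

variable {Λ : SignType}

/-- The vector in `ℝ⁴` which corresponds to (the hermitian part of) a matrix. -/
def ofMat (M : Matrix (Fin 2) (Fin 2) (GenComplex Λ)) : Fin 4 → ℝ :=
  ![((M 0 0).re + (M 1 1).re) / 2, (M 0 1).im, ((M 0 0).re - (M 1 1).re) / 2, (M 0 1).re]

theorem ofMat_toMat (y : Fin 4 → ℝ) : ofMat (toMat Λ y) = y := by
  ext i
  fin_cases i <;> simp [ofMat, toMat]

theorem toMat_injective : Function.Injective (toMat Λ) :=
  Function.LeftInverse.injective ofMat_toMat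

theorem toMat_ofMat {M : Matrix (Fin 2) (Fin 2) (GenComplex Λ)} (hM : M.IsHermitian) :
    toMat Λ (ofMat M) = M := by
  have h := fun i j => hM.apply i j
  have h00 := congrArg QuadraticAlgebra.im (h 0 0)
  have h11 := congrArg QuadraticAlgebra.im (h 1 1)
  have h01 := congrArg QuadraticAlgebra.im (h 1 0)
  have h01' := congrArg QuadraticAlgebra.re (h 1 0)
  simp at h00 h11 h01 h01'
  ext i j
  · fin_cases i <;> fin_cases j <;> simp [ofMat, toMat] <;> linarith
  · fin_cases i <;> fin_cases j <;> simp [ofMat, toMat] <;> linarith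

theorem toMat_isHermitian (y : Fin 4 → ℝ) : (toMat Λ y).IsHermitian := by
  ext i j
  · fin_cases i <;> fin_cases j <;> simp [toMat]
  · fin_cases i <;> fin_cases j <;> simp [toMat]

theorem toMat_add (x y : Fin 4 → ℝ) : toMat Λ (x + y) = toMat Λ x + toMat Λ y := by
  ext i j
  · fin_cases i <;> fin_cases j <;> simp [toMat] <;> ring
  · fin_cases i <;> fin_cases j <;> simp [toMat] <;> ring

theorem toMat_smul (c : ℝ) (y : Fin 4 → ℝ) : toMat Λ (c • y) = c • toMat Λ y := by
  ext i j
  · fin_cases i <;> fin_cases j <;> simp [toMat] <;> ring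
  · fin_cases i <;> fin_cases j <;> simp [toMat]

theorem ofMat_add (M M' : Matrix (Fin 2) (Fin 2) (GenComplex Λ)) :
    ofMat (M + M') = ofMat M + ofMat M' := by
  ext i
  fin_cases i <;> simp [ofMat] <;> ring

theorem ofMat_smul (c : ℝ) (M : Matrix (Fin 2) (Fin 2) (GenComplex Λ)) :
    ofMat (c • M) = c • ofMat M := by
  ext i
  fin_cases i <;> simp [ofMat] <;> ring

/-- The action of `B` on `ℝ⁴`. -/
def act (B : Matrix (Fin 2) (Fin 2) (GenComplex Λ)) : (Fin 4 → ℝ) →ₗ[ℝ] (Fin 4 → ℝ) where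
  toFun y := ofMat (B * toMat Λ y * Bᴴ)
  map_add' x y := by rw [toMat_add, Matrix.mul_add, Matrix.add_mul, ofMat_add]
  map_smul' c y := by
    rw [toMat_smul, Matrix.mul_smul, Matrix.smul_mul, ofMat_smul, RingHom.id_apply]

theorem toMat_act (B : Matrix (Fin 2) (Fin 2) (GenComplex Λ)) (y : Fin 4 → ℝ) :
    toMat Λ (act B y) = B * toMat Λ y * Bᴴ :=
  toMat_ofMat (Matrix.isHermitian_mul_mul_conjTranspose B (toMat_isHermitian y))

theorem act_mul (A B : Matrix (Fin 2) (Fin 2) (GenComplex Λ)) (y : Fin 4 → ℝ) :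
    act (A * B) y = act A (act B y) := by
  apply toMat_injective (Λ := Λ)
  simp only [toMat_act, Matrix.conjTranspose_mul, Matrix.mul_assoc]

theorem IsPGLPlus.mul {A B : Matrix (Fin 2) (Fin 2) (GenComplex Λ)} (hA : IsPGLPlus A)
    (hB : IsPGLPlus B) : IsPGLPlus (A * B) := by
  unfold IsPGLPlus at *
  rw [Matrix.det_mul, map_mul]
  exact mul_pos hA hB

theorem norm_eq (z : GenComplex Λ) :
    QuadraticAlgebra.norm z = z.re ^ 2 + (Λ : ℝ) * z.im ^ 2 := by
  rw [QuadraticAlgebra.norm_def]; ring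

/-- The form is minus a determinant, so multiplicativity gives the scaling in `form_act_self`. -/
theorem det_toMat (y : Fin 4 → ℝ) : (toMat Λ y).det = ⟨-form Λ y y, 0⟩ := by
  rw [toMat, Matrix.det_fin_two_of]
  ext
  · simp [form]; ring
  · simp; ring

theorem form_act_self (B : Matrix (Fin 2) (Fin 2) (GenComplex Λ)) (y : Fin 4 → ℝ) :
    form Λ (act B y) (act B y) = QuadraticAlgebra.norm B.det * form Λ y y := by
  have h := det_toMat (Λ := Λ) (act B y)
  rw [toMat_act, Matrix.det_mul, Matrix.det_mul, Matrix.det_conjTranspose, det_toMat] at h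
  have h1 := congrArg QuadraticAlgebra.re h
  rw [norm_eq]
  simp at h1
  linarith

theorem form_polar (x y : Fin 4 → ℝ) :
    form Λ x y = (form Λ (x + y) (x + y) - form Λ x x - form Λ y y) / 2 := by
  simp [form]; ring

theorem form_act (B : Matrix (Fin 2) (Fin 2) (GenComplex Λ)) (x y : Fin 4 → ℝ) :
    form Λ (act B x) (act B y) = QuadraticAlgebra.norm B.det * form Λ x y := by
  rw [form_polar, ← map_add, form_act_self, form_act_self, form_act_self, form_polar x y]
  ring

/-- Evaluating `volForm_invariant` on the standard basis yields the determinant of the linear map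
`act B`. -/
theorem det_act {B : Matrix (Fin 2) (Fin 2) (GenComplex Λ)} (hB : IsPGLPlus B)
    (y : Fin 4 → Fin 4 → ℝ) :
    (Matrix.of fun i => act B (y i)).det =
      QuadraticAlgebra.norm B.det ^ 2 * (Matrix.of y).det := by
  set e : Fin 4 → Fin 4 → ℝ := fun i => Pi.single i 1 with he
  have h1 : (Matrix.of fun i => act B (y i)) = Matrix.of y * Matrix.of fun i => act B (e i) := by
    ext i j
    rw [Matrix.mul_apply]
    have : y i = ∑ k, y i k • e k := by
      ext l
      simp [he, Pi.single_apply]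
    simp only [Matrix.of_apply]
    conv_lhs => rw [this]
    simp
  have h2 := volForm_invariant Λ B hB (toMat_act B (e 0)) (toMat_act B (e 1))
    (toMat_act B (e 2)) (toMat_act B (e 3))
  have h3 : (Matrix.of ![e 0, e 1, e 2, e 3]) = 1 := by
    ext i j
    fin_cases i <;> fin_cases j <;> simp [he]
  have h4 : (Matrix.of ![act B (e 0), act B (e 1), act B (e 2), act B (e 3)]) =
      Matrix.of fun i => act B (e i) := by
    ext i j
    fin_cases i <;> rfl
  have h5 : form Λ (e 0) (e 0) = -1 := by simp [form, he]
  unfold volForm at h2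
  unfold IsPGLPlus at hB
  rw [h3, h4, form_act, h5, Matrix.det_one, div_eq_iff (by positivity)] at h2
  rw [h1, Matrix.det_mul, h2]
  ring

/-! ### Null vectors and spinors -/

/-- The null vector of a spinor. -/
def spin (v : Fin 2 → GenComplex Λ) : Fin 4 → ℝ := ofMat (Matrix.vecMulVec v (star v))

theorem toMat_spin (v : Fin 2 → GenComplex Λ) : toMat Λ (spin v) = Matrix.vecMulVec v (star v) :=
  toMat_ofMat (by rw [Matrix.IsHermitian, Matrix.conjTranspose_vecMulVec, star_star])

theorem spin_eq (v : Fin 2 → GenComplex Λ) :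
    spin v = ![(QuadraticAlgebra.norm (v 0) + QuadraticAlgebra.norm (v 1)) / 2,
      (v 0).im * (v 1).re - (v 0).re * (v 1).im,
      (QuadraticAlgebra.norm (v 0) - QuadraticAlgebra.norm (v 1)) / 2,
      (v 0).re * (v 1).re + (Λ : ℝ) * ((v 0).im * (v 1).im)] := by
  ext i
  fin_cases i <;> simp [spin, ofMat, Matrix.vecMulVec_apply, norm_eq] <;> ring

/-- The determinant of two vectors. -/
def wedge {R : Type*} [CommRing R] (v w : Fin 2 → R) : R := v 0 * w 1 - v 1 * w 0

theorem act_spin (B : Matrix (Fin 2) (Fin 2) (GenComplex Λ)) (v : Fin 2 → GenComplex Λ) :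
    act B (spin v) = spin (B *ᵥ v) := by
  apply toMat_injective (Λ := Λ)
  rw [toMat_act, toMat_spin, toMat_spin, Matrix.mul_vecMulVec, Matrix.vecMulVec_mul,
    Matrix.star_mulVec]

theorem form_spin (v w : Fin 2 → GenComplex Λ) :
    form Λ (spin v) (spin w) = -(1 / 2) * QuadraticAlgebra.norm (wedge v w) := by
  rw [spin_eq, spin_eq]
  simp [wedge, form, norm_eq]
  ring

/-- The vertices `∞, 0, 1, x + ℓ w` in standard position. -/
def stdVertex (Λ : SignType) (x w : ℝ) : Fin 4 → Fin 4 → ℝ :=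
  ![![1 / 2, 0, 1 / 2, 0], ![1 / 2, 0, -1 / 2, 0], ![1, 0, 0, 1],
    ![(x ^ 2 + Λ * w ^ 2 + 1) / 2, w, (x ^ 2 + Λ * w ^ 2 - 1) / 2, x]]

/-- The pairing hypothesis excludes `y = 0` and, for `Λ = 0`, the radical of the form. The sign
condition for `Λ = -1` compensates for the norm being indefinite there. -/
theorem exists_spin {y y' : Fin 4 → ℝ} (hy : form Λ y y = 0) (hyy' : form Λ y y' ≠ 0) :
    ∃ (c : ℝ) (v : Fin 2 → GenComplex Λ), c ≠ 0 ∧ y = c • spin v ∧ (Λ = -1 → 0 < c) := by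
  suffices h : ∃ (c : ℝ) (v : Fin 2 → GenComplex Λ), c ≠ 0 ∧ y = c • spin v by
    obtain ⟨c, v, hc, rfl⟩ := h
    -- Multiplying the spinor by `ℓ`, of norm `-1`, reverses the sign of its null vector.
    by_cases hΛ : Λ = -1 ∧ c < 0
    · refine ⟨-c, fun i => ⟨0, 1⟩ * v i, neg_ne_zero.2 hc, ?_, fun _ => by linarith [hΛ.2]⟩
      have hL : (Λ : ℝ) = -1 := by rw [hΛ.1]; simp
      rw [spin_eq, spin_eq]
      ext i
      fin_cases i <;> simp [norm_eq] <;> simp only [hL] <;> ring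
    · exact ⟨c, v, hc, rfl, fun h => lt_of_le_of_ne (not_lt.1 fun h' => hΛ ⟨h, h'⟩) hc.symm⟩
  unfold form at hy
  by_cases h0 : y 0 + y 2 = 0
  · by_cases h1 : y 0 - y 2 = 0
    · have e0 : y 0 = 0 := by linarith
      have e2 : y 2 = 0 := by linarith
      have hL : (Λ : ℝ) = 0 ∨ (Λ : ℝ) = -1 ∨ (Λ : ℝ) = 1 := by
        cases Λ <;> simp [SignType.cast]
      rcases hL with hL | hL | hL
      · simp [e0, e2, hL] at hy
        simp [form, e0, e2, hy, hL] at hyy'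
      · simp [e0, e2, hL] at hy
        have h3 : y 3 ≠ 0 := by
          intro h3
          have h4 : y 1 = 0 := by nlinarith
          simp [form, e0, e2, h3, h4] at hyy'
        have hs : (y 1 / y 3) ^ 2 = 1 := by
          field_simp
          linarith
        -- Both diagonal entries vanish, so the spinor has zero divisors `1 ± ℓ` as components.
        refine ⟨y 3 / 2, ![⟨1, y 1 / y 3⟩, ⟨1, -(y 1 / y 3)⟩], by positivity, ?_⟩
        rw [spin_eq]
        ext i
        fin_cases i
        · simp [norm_eq, e0]
          rw [hL]
          right
          linarith
        · simp
          field_simp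
          norm_num
        · simp [norm_eq, e2]
        · simp
          rw [hL]
          linear_combination (-y 3 / 2) * hs
      · simp [e0, e2, hL] at hy
        have h4 : y 1 = 0 := by nlinarith [sq_nonneg (y 1), sq_nonneg (y 3)]
        have h3 : y 3 = 0 := by nlinarith [sq_nonneg (y 1), sq_nonneg (y 3)]
        simp [form, e0, e2, h3, h4] at hyy'
    · refine ⟨y 0 - y 2, ![⟨y 3 / (y 0 - y 2), y 1 / (y 0 - y 2)⟩, 1], h1, ?_⟩
      rw [spin_eq]
      ext i
      fin_cases i <;> simp [norm_eq, QuadraticAlgebra.re_one, QuadraticAlgebra.im_one] <;>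
        field_simp <;> linarith
  · refine ⟨y 0 + y 2, ![1, ⟨y 3 / (y 0 + y 2), -(y 1 / (y 0 + y 2))⟩], h0, ?_⟩
    rw [spin_eq]
    ext i
    fin_cases i <;> simp [norm_eq, QuadraticAlgebra.re_one, QuadraticAlgebra.im_one] <;>
      field_simp <;> linarith

theorem spin_inf (k : GenComplex Λ) (x w : ℝ) :
    spin ![k, 0] = QuadraticAlgebra.norm k • stdVertex Λ x w 0 := by
  rw [spin_eq]
  ext i
  fin_cases i <;> simp [stdVertex] <;> ring

theorem spin_zero (k : GenComplex Λ) (x w : ℝ) :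
    spin ![0, k] = QuadraticAlgebra.norm k • stdVertex Λ x w 1 := by
  rw [spin_eq]
  ext i
  fin_cases i <;> simp [stdVertex] <;> ring

theorem spin_one (k : GenComplex Λ) (x w : ℝ) :
    spin ![k, k] = QuadraticAlgebra.norm k • stdVertex Λ x w 2 := by
  rw [spin_eq]
  ext i
  fin_cases i <;> simp [stdVertex, norm_eq] <;> ring

/-- A matrix which maps three vectors to multiples of `(1, 0)`, `(0, 1)` and `(1, 1)`. -/
def normalizer {R : Type*} [CommRing R] (s₀ s₁ s₂ : Fin 2 → R) : Matrix (Fin 2) (Fin 2) R :=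
  -- On `v` this gives `(s₀∧s₂ · v∧s₁, s₂∧s₁ · s₀∧v)`: the cross ratio in homogeneous form, free of
  -- division and so usable with zero divisors.
  !![wedge s₀ s₂ * s₁ 1, -(wedge s₀ s₂ * s₁ 0); -(wedge s₂ s₁ * s₀ 1), wedge s₂ s₁ * s₀ 0]

section normalizer

variable {R : Type*} [CommRing R] (s₀ s₁ s₂ : Fin 2 → R)

theorem det_normalizer :
    (normalizer s₀ s₁ s₂).det = wedge s₀ s₂ * wedge s₂ s₁ * wedge s₀ s₁ := by
  rw [normalizer, Matrix.det_fin_two_of, wedge, wedge, wedge]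
  ring

theorem normalizer_mulVec_zero :
    normalizer s₀ s₁ s₂ *ᵥ s₀ = ![wedge s₀ s₂ * wedge s₀ s₁, 0] := by
  ext i
  fin_cases i <;> simp [normalizer, wedge, Matrix.mulVec, dotProduct] <;> ring

theorem normalizer_mulVec_one :
    normalizer s₀ s₁ s₂ *ᵥ s₁ = ![0, wedge s₂ s₁ * wedge s₀ s₁] := by
  ext i
  fin_cases i <;> simp [normalizer, wedge, Matrix.mulVec, dotProduct] <;> ring

theorem normalizer_mulVec_two :
    normalizer s₀ s₁ s₂ *ᵥ s₂ = ![wedge s₀ s₂ * wedge s₂ s₁, wedge s₀ s₂ * wedge s₂ s₁] := by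
  ext i
  fin_cases i <;> simp [normalizer, wedge, Matrix.mulVec, dotProduct] <;> ring

end normalizer

/-- Lifts of the vertices of a nondegenerate ideal tetrahedron. -/
structure IsIdealFrame (Λ : SignType) (y : Fin 4 → Fin 4 → ℝ) : Prop where
  null : ∀ i, form Λ (y i) (y i) = 0
  neg : ∀ i j, i ≠ j → form Λ (y i) (y j) < 0
  det_ne_zero : (Matrix.of y).det ≠ 0

theorem IsIdealFrame.exists_standard {y : Fin 4 → Fin 4 → ℝ} (hy : IsIdealFrame Λ y) :
    ∃ (B : Matrix (Fin 2) (Fin 2) (GenComplex Λ)) (x w : ℝ), IsPGLPlus B ∧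
      ∀ i, ∃ c : ℝ, c ≠ 0 ∧ act B (y i) = c • stdVertex Λ x w i := by
  have hsp : ∀ i, ∃ (c : ℝ) (v : Fin 2 → GenComplex Λ), c ≠ 0 ∧ y i = c • spin v ∧
      (Λ = -1 → 0 < c) := by
    intro i
    obtain ⟨j, hj⟩ := exists_ne i
    exact exists_spin (hy.null i) (hy.neg i j hj.symm).ne
  choose c s hc hs hpos using hsp
  have hD : ∀ i j, i ≠ j → 0 < QuadraticAlgebra.norm (wedge (s i) (s j)) := by
    intro i j hij
    have h := hy.neg i j hij
    have e : form Λ (c i • spin (s i)) (c j • spin (s j)) =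
        c i * c j * form Λ (spin (s i)) (spin (s j)) := by simp [form]; ring
    rw [hs i, hs j, e, form_spin] at h
    by_cases hΛ : Λ = -1
    · have := mul_pos (hpos i hΛ) (hpos j hΛ)
      by_contra! h'
      nlinarith
    · refine lt_of_le_of_ne ?_ fun h' => by simp [← h'] at h
      rw [norm_eq]
      have : (0 : ℝ) ≤ (Λ : ℝ) := by
        cases Λ
        · simp [SignType.cast]
        · exact absurd rfl hΛ
        · simp [SignType.cast]
      positivity
  have p0 := hD 0 2 (by decide)
  have p1 := hD 2 1 (by decide)
  have p2 := hD 0 1 (by decide)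
  set B := normalizer (s 0) (s 1) (s 2) with hBdef
  have hB : IsPGLPlus B := by
    rw [IsPGLPlus, hBdef, det_normalizer, map_mul, map_mul]
    positivity
  have a0 (x w : ℝ) := calc
    act B (y 0) = c 0 • spin (B *ᵥ s 0) := by rw [hs 0, map_smul, act_spin]
    _ = _ := by rw [hBdef, normalizer_mulVec_zero, spin_inf _ x w, smul_smul, map_mul]
  have a1 (x w : ℝ) := calc
    act B (y 1) = c 1 • spin (B *ᵥ s 1) := by rw [hs 1, map_smul, act_spin]
    _ = _ := by rw [hBdef, normalizer_mulVec_one, spin_zero _ x w, smul_smul, map_mul]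
  have a2 (x w : ℝ) := calc
    act B (y 2) = c 2 • spin (B *ᵥ s 2) := by rw [hs 2, map_smul, act_spin]
    _ = _ := by rw [hBdef, normalizer_mulVec_two, spin_one _ x w, smul_smul, map_mul]
  have n0 := mul_ne_zero (hc 0) (mul_pos p0 p2).ne'
  have n1 := mul_ne_zero (hc 1) (mul_pos p1 p2).ne'
  have n2 := mul_ne_zero (hc 2) (mul_pos p0 p1).ne'
  set u := act B (y 3) with hu
  have hnull : form Λ u u = 0 := by rw [hu, form_act, hy.null, mul_zero]
  -- Up to a nonzero factor, this is the pairing of the fourth vertex with the one at `∞`. Dividing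
  -- by it makes the lower right entry 1.
  have hne : u 0 - u 2 ≠ 0 := by
    have h := form_act B (y 3) (y 0)
    rw [← hu, a0 0 0] at h
    intro h'
    have h0 : ∀ k : ℝ, form Λ u (k • stdVertex Λ 0 0 0) = 0 := by
      intro k
      have e : u 2 = u 0 := by linarith
      simp [form, stdVertex, e]
    rw [h0] at h
    have := hy.neg 3 0 (by decide)
    unfold IsPGLPlus at hB
    nlinarith
  refine ⟨B, u 3 / (u 0 - u 2), u 1 / (u 0 - u 2), hB, fun i => ?_⟩
  fin_cases i
  · exact ⟨_, n0, a0 _ _⟩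
  · exact ⟨_, n1, a1 _ _⟩
  · exact ⟨_, n2, a2 _ _⟩
  · refine ⟨u 0 - u 2, hne, ?_⟩
    unfold form at hnull
    simp only [Fin.reduceFinMk]
    rw [← hu]
    ext i
    fin_cases i <;> simp [stdVertex] <;> field_simp <;> linarith

end GenIdeal

end

noncomputable section

namespace GenIdeal

/-! ### Generalized dihedral angles -/

section Angles

variable {Λ : SignType}

theorem form_comm (x y : Fin 4 → ℝ) : form Λ x y = form Λ y x := by
  simp only [form]; ring

theorem IsIdealFrame.comp {y : Fin 4 → Fin 4 → ℝ} (hy : IsIdealFrame Λ y)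
    (σ : Equiv.Perm (Fin 4)) : IsIdealFrame Λ (y ∘ σ) where
  null i := hy.null _
  neg i j hij := hy.neg _ _ (σ.injective.ne hij)
  det_ne_zero := by
    have : Matrix.of (y ∘ σ) = (Matrix.of y).submatrix σ id := rfl
    rw [this, Matrix.det_permute]
    exact mul_ne_zero (by exact_mod_cast (Equiv.Perm.sign σ).ne_zero) hy.det_ne_zero

/-- Two vertices pair negatively because the sum of their lifts represents a point of `Y Λ`, and its
form is twice the pairing. -/
theorem IdealTetrahedron.isIdealFrame (T : IdealTetrahedron Λ) : IsIdealFrame Λ T.lift where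
  null i := T.vertex_mem i _ (by
    rw [Projectivization.submodule_mk]
    exact Submodule.mem_span_singleton_self _)
  neg i j hij := by
    set b : Fin 4 → ℝ := Pi.single i 1 + Pi.single j 1 with hb
    have hsum : ∑ l, b l • T.lift l = T.lift i + T.lift j := by
      simp [hb, add_smul, Finset.sum_add_distrib, Pi.single_apply]
    have hbi : b i = 1 := by simp [hb, hij]
    have hbj : b j = 1 := by simp [hb, hij.symm]
    have hli := Fintype.linearIndependent_iff.1 T.indep
    have hne : ∑ l, b l • T.lift l ≠ 0 := fun h => by
      have := hli b h i
      rw [hbi] at this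
      exact one_ne_zero this
    have h := T.interior_mem b hne (fun l => by
      simp only [hb, Pi.add_apply, Pi.single_apply]; positivity) ?_
    · rw [mk_mem_Y, hsum, form_polar (T.lift i) (T.lift j)] at *
      have hi : form Λ (T.lift i) (T.lift i) = 0 := T.vertex_mem i _ (by
        rw [Projectivization.submodule_mk]
        exact Submodule.mem_span_singleton_self _)
      have hj : form Λ (T.lift j) (T.lift j) = 0 := T.vertex_mem j _ (by
        rw [Projectivization.submodule_mk]
        exact Submodule.mem_span_singleton_self _)
      linarith
    · intro k hk
      obtain ⟨a, ha⟩ := (Projectivization.mk_eq_mk_iff' ℝ _ _ hne (T.indep.ne_zero k)).1 hk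
      have h0 : ∑ l, (b l - a * (if l = k then 1 else 0)) • T.lift l = 0 := by
        simp [sub_smul, Finset.sum_sub_distrib, ← ha]
      have h1 := hli _ h0 i
      have h2 := hli _ h0 j
      rw [hbi] at h1
      rw [hbj] at h2
      by_cases hik : i = k
      · have hjk : j ≠ k := fun h => hij (hik.trans h.symm)
        simp [hjk] at h2
      · simp [hik] at h1
  det_ne_zero := by
    have : IsUnit (Matrix.of T.lift) := Matrix.linearIndependent_rows_iff_isUnit.1 T.indep
    exact ((Matrix.isUnit_iff_isUnit_det _).1 this).ne_zero

/-- The matrix `B` maps the four vectors `y` to the vertices `∞, 0, 1, x + ℓ w`. -/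
def IsStandardized (B : Matrix (Fin 2) (Fin 2) (GenComplex Λ)) (y : Fin 4 → Fin 4 → ℝ)
    (x w : ℝ) : Prop :=
  IsPGLPlus B ∧ ∀ i, ∃ c : ℝ, c ≠ 0 ∧ act B (y i) = c • stdVertex Λ x w i

theorem hasDihedralAngles_iff {y : Fin 4 → Fin 4 → ℝ}
    {B : Matrix (Fin 2) (Fin 2) (GenComplex Λ)} {α β γ : ℝ} :
    HasDihedralAngles Λ y B α β γ ↔ α + β + γ = 0 ∧ genSin Λ α ≠ 0 ∧
      IsStandardized B y (-(genSin Λ β / genSin Λ α * genCos Λ γ))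
        (-(genSin Λ β / genSin Λ α * genSin Λ γ)) := by
  unfold HasDihedralAngles IsStandardized
  refine and_congr_right fun _ => and_congr_right fun _ => and_congr_right fun _ =>
    forall_congr' fun i => exists_congr fun c => and_congr_right fun _ => ?_
  rw [← (toMat_injective (Λ := Λ)).eq_iff, toMat_act, toMat_smul]
  refine iff_of_eq (congrArg (fun M => B * toMat Λ (y i) * Bᴴ = c • M) ?_)
  have h := genCos_sq Λ γ
  fin_cases i
  · ext i j
    · fin_cases i <;> fin_cases j <;> simp [toMat, stdVertex, QuadraticAlgebra.re_one] <;> norm_num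
    · fin_cases i <;> fin_cases j <;> simp [toMat, stdVertex, QuadraticAlgebra.im_one]
  · ext i j
    · fin_cases i <;> fin_cases j <;> simp [toMat, stdVertex, QuadraticAlgebra.re_one] <;> norm_num
    · fin_cases i <;> fin_cases j <;> simp [toMat, stdVertex, QuadraticAlgebra.im_one]
  · ext i j
    · fin_cases i <;> fin_cases j <;> simp [toMat, stdVertex, QuadraticAlgebra.re_one]
    · fin_cases i <;> fin_cases j <;> simp [toMat, stdVertex, QuadraticAlgebra.im_one]
  · generalize genSin Λ β / genSin Λ α = q
    ext i j
    · fin_cases i <;> fin_cases j <;>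
        simp [toMat, stdVertex, QuadraticAlgebra.re_one, genExp, genCos_neg]
      · linear_combination (-q ^ 2) * h
      · ring
    · fin_cases i <;> fin_cases j <;>
        simp [toMat, stdVertex, QuadraticAlgebra.im_one, genExp, genSin_neg]

theorem form_stdVertex (x w : ℝ) :
    form Λ (stdVertex Λ x w 0) (stdVertex Λ x w 1) = -(1 / 2) ∧
    form Λ (stdVertex Λ x w 0) (stdVertex Λ x w 2) = -(1 / 2) ∧
    form Λ (stdVertex Λ x w 0) (stdVertex Λ x w 3) = -(1 / 2) ∧
    form Λ (stdVertex Λ x w 1) (stdVertex Λ x w 2) = -(1 / 2) ∧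
    form Λ (stdVertex Λ x w 1) (stdVertex Λ x w 3) = -((x ^ 2 + Λ * w ^ 2) / 2) ∧
    form Λ (stdVertex Λ x w 2) (stdVertex Λ x w 3) = -(((x - 1) ^ 2 + Λ * w ^ 2) / 2) := by
  refine ⟨?_, ?_, ?_, ?_, ?_, ?_⟩ <;> simp [form, stdVertex] <;> ring

theorem det_stdVertex (x w : ℝ) : (Matrix.of (stdVertex Λ x w)).det = -(w / 2) := by
  simp [stdVertex, Matrix.det_succ_row_zero, Fin.sum_univ_succ, Fin.succAbove]
  ring

/-! ### Signs and determinants in standard position -/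

section Standardized

variable {y : Fin 4 → Fin 4 → ℝ} {B : Matrix (Fin 2) (Fin 2) (GenComplex Λ)} {x w : ℝ}
  {c : Fin 4 → ℝ}

theorem form_of_act_eq (h : ∀ i, act B (y i) = c i • stdVertex Λ x w i) (i j : Fin 4) :
    QuadraticAlgebra.norm B.det * form Λ (y i) (y j) =
      c i * c j * form Λ (stdVertex Λ x w i) (stdVertex Λ x w j) := by
  rw [← form_act, h, h, form_smul_smul]

theorem det_of_act_eq (hB : IsPGLPlus B) (h : ∀ i, act B (y i) = c i • stdVertex Λ x w i) :
    QuadraticAlgebra.norm B.det ^ 2 * (Matrix.of y).det = (∏ i, c i) * -(w / 2) := by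
  rw [← det_act hB, ← det_stdVertex (Λ := Λ) x w, ← Matrix.det_mul_column]
  congr 1
  ext i j
  simp [h]

/-- The standard vertex at `∞` has pairing `-1/2` with each other one, so all `c i` have the same
sign. The remaining pairings give `|z|² > 0` and `|z - 1|² > 0`. -/
theorem IsIdealFrame.standardized (hy : IsIdealFrame Λ y) (hB : IsPGLPlus B)
    (h : ∀ i, act B (y i) = c i • stdVertex Λ x w i) :
    (∀ i j, 0 < c i * c j) ∧ 0 < x ^ 2 + Λ * w ^ 2 ∧ 0 < (x - 1) ^ 2 + Λ * w ^ 2 ∧ w ≠ 0 := by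
  obtain ⟨f01, f02, f03, f12, f13, f23⟩ := form_stdVertex (Λ := Λ) x w
  unfold IsPGLPlus at hB
  have key : ∀ i j, i ≠ j →
      c i * c j * form Λ (stdVertex Λ x w i) (stdVertex Λ x w j) < 0 := fun i j hij => by
    rw [← form_of_act_eq h]
    exact mul_neg_of_pos_of_neg hB (hy.neg i j hij)
  have h1 := key 0 1 (by decide)
  have h2 := key 0 2 (by decide)
  have h3 := key 0 3 (by decide)
  have h4 := key 1 3 (by decide)
  have h5 := key 2 3 (by decide)
  rw [f01] at h1
  rw [f02] at h2
  rw [f03] at h3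
  rw [f13] at h4
  rw [f23] at h5
  have p1 : 0 < c 0 * c 1 := by linarith
  have p2 : 0 < c 0 * c 2 := by linarith
  have p3 : 0 < c 0 * c 3 := by linarith
  have hc0 : c 0 ≠ 0 := by rintro h; simp [h] at p1
  have p0 : ∀ i, 0 < c 0 * c i := by
    intro i
    fin_cases i
    · exact mul_self_pos.2 hc0
    · exact p1
    · exact p2
    · exact p3
  have pij : ∀ i j, 0 < c i * c j := fun i j => by
    have := mul_pos (p0 i) (p0 j)
    have h' : c 0 * c i * (c 0 * c j) = c 0 ^ 2 * (c i * c j) := by ring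
    rw [h'] at this
    exact (pos_iff_pos_of_mul_pos this).1 (by positivity)
  refine ⟨pij, ?_, ?_, ?_⟩
  · have := pij 1 3
    by_contra! h'
    nlinarith
  · have := pij 2 3
    by_contra! h'
    nlinarith
  · rintro rfl
    have hB' : IsPGLPlus B := hB
    have := det_of_act_eq hB' h
    rw [zero_div, neg_zero, mul_zero] at this
    exact mul_ne_zero (by positivity) hy.det_ne_zero this

end Standardized

theorem IsIdealFrame.exists_angles {y : Fin 4 → Fin 4 → ℝ} (hy : IsIdealFrame Λ y) :
    ∃ (B : Matrix (Fin 2) (Fin 2) (GenComplex Λ)) (α β γ : ℝ),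
      HasDihedralAngles Λ y B α β γ := by
  obtain ⟨B, x, w, hB, hst⟩ := hy.exists_standard
  choose c hc hact using hst
  obtain ⟨-, hZ, hW, hw⟩ := hy.standardized hB hact
  obtain ⟨r, γ, hr, rfl, rfl⟩ := exists_genPolar Λ x w hZ
  have hγ : genSin Λ γ ≠ 0 := right_ne_zero_of_mul hw
  have hcs := genCos_sq Λ γ
  -- The number is `r - exp(-ℓγ) = exp(-ℓγ) (z - 1)`, so `z - 1 = ρ exp(ℓ(α+γ))`; comparing with `z
  -- = r exp(ℓγ)` gives `s(α+γ) = r s(α)`.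
  obtain ⟨ρ, α, hρ, h1, h2⟩ := exists_genPolar Λ (r - genCos Λ γ) (genSin Λ γ) (by
    have : (r - genCos Λ γ) ^ 2 + Λ * genSin Λ γ ^ 2 =
        (r * genCos Λ γ - 1) ^ 2 + Λ * (r * genSin Λ γ) ^ 2 := by
      linear_combination (1 - r ^ 2) * hcs
    rwa [this])
  have hα : genSin Λ α ≠ 0 := fun h => hγ (by rw [h2, h, mul_zero])
  have hs : genSin Λ (-(α + γ)) = -(r * genSin Λ α) := by
    rw [genSin_neg, genSin_add]
    have : ρ * (genSin Λ α * genCos Λ γ + genCos Λ α * genSin Λ γ) = ρ * (r * genSin Λ α) := by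
      linear_combination (r - genCos Λ γ) * h2 - genSin Λ γ * h1
    rw [mul_left_cancel₀ hρ this]
  refine ⟨B, α, -(α + γ), γ, hasDihedralAngles_iff.2 ⟨by ring, hα, hB, fun i => ⟨c i, hc i, ?_⟩⟩⟩
  rw [hact i, hs]
  congr 3 <;> field_simp

/-- The law of sines for the triangle `0, 1, z`: the values of `|z|²`, `|z - 1|²` and `Re (1 - z)`.
-/
theorem HasDihedralAngles.norm_sq {α β γ : ℝ} (hsum : α + β + γ = 0) (hα : genSin Λ α ≠ 0) :
    (-(genSin Λ β / genSin Λ α * genCos Λ γ)) ^ 2 +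
      Λ * (-(genSin Λ β / genSin Λ α * genSin Λ γ)) ^ 2 = (genSin Λ β / genSin Λ α) ^ 2 ∧
    (-(genSin Λ β / genSin Λ α * genCos Λ γ) - 1) ^ 2 +
      Λ * (-(genSin Λ β / genSin Λ α * genSin Λ γ)) ^ 2 = (genSin Λ γ / genSin Λ α) ^ 2 ∧
    1 + genSin Λ β / genSin Λ α * genCos Λ γ = -(genSin Λ γ / genSin Λ α * genCos Λ β) := by
  have hs : genSin Λ α = -(genSin Λ β * genCos Λ γ + genCos Λ β * genSin Λ γ) := by
    rw [← genSin_add, ← genSin_neg]; congr 1; linarith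
  have h1 := genCos_sq Λ γ
  have h2 := genCos_sq Λ β
  have h3 : 1 + genSin Λ β / genSin Λ α * genCos Λ γ =
      -(genSin Λ γ / genSin Λ α * genCos Λ β) := by
    field_simp
    linarith
  refine ⟨by linear_combination (genSin Λ β / genSin Λ α) ^ 2 * h1, ?_, h3⟩
  have h4 : -(genSin Λ β / genSin Λ α * genCos Λ γ) - 1 = genSin Λ γ / genSin Λ α * genCos Λ β := by
    linarith
  rw [h4]
  field_simp
  linear_combination (genSin Λ γ) ^ 2 * h2

theorem HasDihedralAngles.genSin_ne_zero {y : Fin 4 → Fin 4 → ℝ} (hy : IsIdealFrame Λ y)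
    {B : Matrix (Fin 2) (Fin 2) (GenComplex Λ)} {α β γ : ℝ}
    (h : HasDihedralAngles Λ y B α β γ) :
    genSin Λ α ≠ 0 ∧ genSin Λ β ≠ 0 ∧ genSin Λ γ ≠ 0 := by
  obtain ⟨-, hα, hB, hst⟩ := hasDihedralAngles_iff.1 h
  choose c hc hact using hst
  obtain ⟨-, -, -, hw⟩ := hy.standardized hB hact
  rw [neg_ne_zero, mul_ne_zero_iff, div_ne_zero_iff] at hw
  exact ⟨hα, hw.1.1, hw.2⟩

/-! ### Relabelling of the vertices -/

theorem IsStandardized.relabel {y : Fin 4 → Fin 4 → ℝ}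
    {B R : Matrix (Fin 2) (Fin 2) (GenComplex Λ)} {x w x' w' : ℝ} (h : IsStandardized B y x w)
    (hR : IsPGLPlus R) (σ : Equiv.Perm (Fin 4))
    (hσ : ∀ i, ∃ k : ℝ, k ≠ 0 ∧ act R (stdVertex Λ x w (σ i)) = k • stdVertex Λ x' w' i) :
    IsStandardized (R * B) (y ∘ σ) x' w' := by
  refine ⟨hR.mul h.1, fun i => ?_⟩
  obtain ⟨c, hc, h1⟩ := h.2 (σ i)
  obtain ⟨k, hk, h2⟩ := hσ i
  exact ⟨c * k, mul_ne_zero hc hk, by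
    rw [act_mul, Function.comp_apply, h1, map_smul, h2, smul_smul]⟩

theorem act_swap (y : Fin 4 → ℝ) :
    act (!![0, 1; 1, 0] : Matrix _ _ (GenComplex Λ)) y = ![y 0, -y 1, -y 2, y 3] := by
  ext i
  fin_cases i <;>
    simp [act, ofMat, toMat, Matrix.mul_apply, Fin.sum_univ_two] <;> ring

theorem act_cycle (y : Fin 4 → ℝ) :
    act (!![0, 1; -1, 1] : Matrix _ _ (GenComplex Λ)) y =
      ![(3 * y 0 - y 2 - 2 * y 3) / 2, y 1, (2 * y 3 - y 0 - y 2) / 2, y 0 - y 2 - y 3] := by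
  ext i
  fin_cases i <;>
    simp [act, ofMat, toMat, Matrix.mul_apply, Fin.sum_univ_two] <;> ring

/-- Exchanging `∞` and `0` is the map `z ↦ 1/z`; the fourth vertex is rescaled by `|z|²`. -/
theorem HasDihedralAngles.swap {y : Fin 4 → Fin 4 → ℝ}
    {B : Matrix (Fin 2) (Fin 2) (GenComplex Λ)} {α β γ : ℝ}
    (h : HasDihedralAngles Λ y B α β γ) (hβ : genSin Λ β ≠ 0) :
    HasDihedralAngles Λ (y ∘ Equiv.swap 0 1) (!![0, 1; 1, 0] * B) (-β) (-α) (-γ) := by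
  obtain ⟨hsum, hα, hst⟩ := hasDihedralAngles_iff.1 h
  obtain ⟨hZ, -, -⟩ := HasDihedralAngles.norm_sq hsum hα
  refine hasDihedralAngles_iff.2 ⟨by linarith, by rwa [genSin_neg, neg_ne_zero],
    hst.relabel (by simp [IsPGLPlus, Matrix.det_fin_two_of]) _ fun i => ?_⟩
  simp only [genSin_neg, genCos_neg, neg_div_neg_eq]
  have hc := genCos_sq Λ γ
  fin_cases i
  · refine ⟨1, one_ne_zero, ?_⟩
    rw [act_swap]
    ext i
    fin_cases i <;> simp [stdVertex] <;> norm_num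
  · refine ⟨1, one_ne_zero, ?_⟩
    rw [act_swap]
    ext i
    fin_cases i <;> simp [stdVertex] <;> norm_num
  · refine ⟨1, one_ne_zero, ?_⟩
    rw [act_swap]
    ext i
    fin_cases i <;> simp [stdVertex, Equiv.swap_apply_def]
  · refine ⟨(genSin Λ β / genSin Λ α) ^ 2, by positivity, ?_⟩
    rw [act_swap]
    ext i
    fin_cases i
    · simp [stdVertex, Equiv.swap_apply_def]
      field_simp
      linear_combination (genSin Λ β ^ 2 - genSin Λ α ^ 2) * hc
    · simp [stdVertex, Equiv.swap_apply_def]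
      field_simp
    · simp [stdVertex, Equiv.swap_apply_def]
      field_simp
      linear_combination (-genSin Λ β ^ 2 - genSin Λ α ^ 2) * hc
    · simp [stdVertex, Equiv.swap_apply_def]
      field_simp

/-- The map `z ↦ 1/(1-z)` sends `1, ∞, 0` to `∞, 0, 1`; the fourth vertex is rescaled by `|1-z|²`.
-/
theorem HasDihedralAngles.cycle {y : Fin 4 → Fin 4 → ℝ}
    {B : Matrix (Fin 2) (Fin 2) (GenComplex Λ)} {α β γ : ℝ}
    (h : HasDihedralAngles Λ y B α β γ) (hγ : genSin Λ γ ≠ 0) :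
    HasDihedralAngles Λ (y ∘ (Equiv.swap 0 1 * Equiv.swap 0 2 : Equiv.Perm (Fin 4)))
      (!![0, 1; -1, 1] * B) γ α β := by
  obtain ⟨hsum, hα, hst⟩ := hasDihedralAngles_iff.1 h
  obtain ⟨hZ, hW, hx⟩ := HasDihedralAngles.norm_sq hsum hα
  refine hasDihedralAngles_iff.2 ⟨by linarith, hγ,
    hst.relabel (by simp [IsPGLPlus, Matrix.det_fin_two_of]) _ fun i => ?_⟩
  have hc := genCos_sq Λ β
  have h0 : (Equiv.swap 0 1 * Equiv.swap 0 2 : Equiv.Perm (Fin 4)) 0 = 2 := by decide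
  have h1 : (Equiv.swap 0 1 * Equiv.swap 0 2 : Equiv.Perm (Fin 4)) 1 = 0 := by decide
  have h2 : (Equiv.swap 0 1 * Equiv.swap 0 2 : Equiv.Perm (Fin 4)) 2 = 1 := by decide
  have h3 : (Equiv.swap 0 1 * Equiv.swap 0 2 : Equiv.Perm (Fin 4)) 3 = 3 := by decide
  fin_cases i
  · refine ⟨1, one_ne_zero, ?_⟩
    simp only [Fin.zero_eta, h0]
    rw [act_cycle]
    ext i
    fin_cases i <;> simp [stdVertex] <;> norm_num
  · refine ⟨1, one_ne_zero, ?_⟩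
    simp only [Fin.mk_one, h1]
    rw [act_cycle]
    ext i
    fin_cases i <;> simp [stdVertex] <;> norm_num
  · refine ⟨1, one_ne_zero, ?_⟩
    simp only [Fin.reduceFinMk, h2]
    rw [act_cycle]
    ext i
    fin_cases i <;> simp [stdVertex] <;> norm_num
  · refine ⟨(genSin Λ γ / genSin Λ α) ^ 2, by positivity, ?_⟩
    simp only [Fin.reduceFinMk, h3]
    have hZ' : (-(genSin Λ α / genSin Λ γ * genCos Λ β)) ^ 2 +
        Λ * (-(genSin Λ α / genSin Λ γ * genSin Λ β)) ^ 2 = (genSin Λ α / genSin Λ γ) ^ 2 := by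
      linear_combination (genSin Λ α / genSin Λ γ) ^ 2 * hc
    have hq : (genSin Λ γ / genSin Λ α) ^ 2 * (genSin Λ α / genSin Λ γ) ^ 2 = 1 := by
      field_simp
    have hq' : (genSin Λ γ / genSin Λ α) ^ 2 * (genSin Λ α / genSin Λ γ) =
        genSin Λ γ / genSin Λ α := by
      field_simp
    rw [act_cycle]
    ext i
    fin_cases i
    · simp only [stdVertex, Fin.zero_eta, Matrix.cons_val, Pi.smul_apply, smul_eq_mul, hZ']
      linear_combination hW / 2 - hq / 2
    · simp only [stdVertex, Fin.mk_one, Matrix.cons_val, Pi.smul_apply, smul_eq_mul]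
      field_simp
    · simp only [stdVertex, Fin.reduceFinMk, Matrix.cons_val, Pi.smul_apply, smul_eq_mul, hZ']
      linear_combination -hW / 2 - hq / 2
    · simp only [stdVertex, Fin.reduceFinMk, Matrix.cons_val, Pi.smul_apply, smul_eq_mul]
      linear_combination hx + genCos Λ β * hq'

end Angles

end GenIdeal

end

noncomputable section

namespace GenIdeal

section VolumeFormula

variable {Λ : SignType}

/-! ### The volume for positive angles -/

theorem form_vecMul_self (A : Matrix (Fin 4) (Fin 4) ℝ) (b : Fin 4 → ℝ) :
    form Λ (b ᵥ* A) (b ᵥ* A) = ∑ i, ∑ j, b i * b j * form Λ (A i) (A j) := by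
  simp [form, Matrix.vecMul, dotProduct, Fin.sum_univ_four]
  ring

theorem IdealTetrahedron.vol_of_pos_angles (T : IdealTetrahedron Λ) (σ : Equiv.Perm (Fin 4))
    {B : Matrix (Fin 2) (Fin 2) (GenComplex Λ)} {α β γ : ℝ}
    (h : HasDihedralAngles Λ (T.lift ∘ σ) B α β γ) (hα : 0 < α) (hβ : 0 < β)
    (hαβ : Λ = 1 → α + β < Real.pi) :
    vol Λ T.carrier = ENNReal.ofReal (clausenSum Λ α β γ) ∧ 0 ≤ clausenSum Λ α β γ ∧
      (Matrix.of (T.lift ∘ σ)).det < 0 := by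
  obtain ⟨hsum, hα', hB, hst⟩ := hasDihedralAngles_iff.1 h
  have hfr := T.isIdealFrame.comp σ
  obtain ⟨hZ, hW, -⟩ := HasDihedralAngles.norm_sq hsum hα'
  choose c hc hact using hst
  obtain ⟨hcc, -, -, -⟩ := hfr.standardized hB hact
  have hform := form_of_act_eq hact
  have hdet := det_of_act_eq hB hact
  obtain ⟨f01, f02, f03, f12, f13, f23⟩ := form_stdVertex (Λ := Λ)
    (-(genSin Λ β / genSin Λ α * genCos Λ γ)) (-(genSin Λ β / genSin Λ α * genSin Λ γ))
  rw [hZ] at f13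
  rw [hW] at f23
  have ha : 0 < genSin Λ α := genSin_pos Λ hα fun h => by linarith [hαβ h]
  have hb : 0 < genSin Λ β := genSin_pos Λ hβ fun h => by linarith [hαβ h]
  have hg : 0 < genSin Λ (α + β) := genSin_pos Λ (by linarith) hαβ
  have hγ : γ = -(α + β) := by linarith
  have hsγ : genSin Λ γ = -genSin Λ (α + β) := by rw [hγ, genSin_neg]
  rw [hsγ] at hdet
  generalize stdVertex Λ (-(genSin Λ β / genSin Λ α * genCos Λ γ))
    (-(genSin Λ β / genSin Λ α * genSin Λ γ)) = v at hform f01 f02 f03 f12 f13 f23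
  rw [hsγ] at f23
  set N := QuadraticAlgebra.norm B.det with hN
  have hN0 : 0 < N := hB
  set s := Real.sqrt N with hs
  have hs0 : 0 < s := Real.sqrt_pos.2 hN0
  have hsN : s ^ 2 = N := Real.sq_sqrt hN0.le
  set a := genSin Λ α with hadef
  set b := genSin Λ β with hbdef
  set g := genSin Λ (α + β) with hgdef
  -- These weights solve `l₀l₃ = l₁l₃|z|² = l₂l₃|z-1|² = 1`, which produces `angleForm`; their
  -- product is `a²`.
  set l : Fin 4 → ℝ := ![b * g / a, a * g / b, a * b / g, a / (b * g)] with hl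
  have hl0 : ∀ i, 0 < l i := by
    intro i
    fin_cases i <;> simp [hl] <;> positivity
  set k : Fin 4 → ℝ := fun i => l i * s / c i with hk
  have hkk : ∀ i j, 0 < k i * k j := fun i j => by
    have e : k i * k j = l i * l j * s ^ 2 / (c i * c j) := by
      simp only [hk]
      have := hc i
      have := hc j
      field_simp
    rw [e]
    exact div_pos (mul_pos (mul_pos (hl0 i) (hl0 j)) (by positivity)) (hcc i j)
  set A : Matrix (Fin 4) (Fin 4) ℝ := Matrix.of fun i => k i • T.lift (σ i) with hA
  have hAform : ∀ i j, form Λ (A i) (A j) = l i * l j * form Λ (v i) (v j) := by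
    intro i j
    have h1 := hform i j
    have hi := hc i
    have hj := hc j
    have h2 : form Λ (A i) (A j) = k i * k j * form Λ ((T.lift ∘ σ) i) ((T.lift ∘ σ) j) :=
      form_smul_smul Λ _ _ _ _
    have h3 : form Λ ((T.lift ∘ σ) i) ((T.lift ∘ σ) j) =
        c i * c j * form Λ (v i) (v j) / s ^ 2 := by
      rw [eq_div_iff (by positivity), hsN]
      linarith
    rw [h2, h3]
    simp only [hk]
    field_simp
  have hAnull : ∀ i, form Λ (A i) (A i) = 0 := fun i => by
    have h2 : form Λ (A i) (A i) = k i * k i * form Λ ((T.lift ∘ σ) i) ((T.lift ∘ σ) i) :=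
      form_smul_smul Λ _ _ _ _
    rw [h2, hfr.null, mul_zero]
  have hAdet : A.det = (∏ i, k i) * (Matrix.of (T.lift ∘ σ)).det := by
    rw [← Matrix.det_mul_column]
    rfl
  have hprodc : 0 < ∏ i, c i := by
    rw [Fin.prod_univ_four, mul_assoc]
    exact mul_pos (hcc 0 1) (hcc 2 3)
  have hdet' : (Matrix.of (T.lift ∘ σ)).det = -((∏ i, c i) * (b / a * g / 2) / N ^ 2) := by
    rw [eq_neg_iff_add_eq_zero, add_comm, div_add' _ _ _ (by positivity), div_eq_zero_iff]
    left
    linear_combination hdet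
  have hAdet' : A.det = -(a * b * g / 2) := by
    rw [hAdet, hdet', ← hsN]
    simp only [Fin.prod_univ_four, hk, hl]
    have h0 := hc 0
    have h1 := hc 1
    have h2 := hc 2
    have h3 := hc 3
    simp only [Matrix.cons_val]
    field_simp
  have hq : ∀ x, form Λ (x ᵥ* A) (x ᵥ* A) = -angleForm Λ α β x := by
    intro x
    rw [form_vecMul_self]
    simp only [Fin.sum_univ_four, hAnull]
    rw [form_comm (A 1) (A 0), form_comm (A 2) (A 0), form_comm (A 3) (A 0),
      form_comm (A 2) (A 1), form_comm (A 3) (A 1), form_comm (A 3) (A 2)]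
    simp only [hAform, f01, f02, f03, f12, f13, f23]
    simp only [hl, Matrix.cons_val, angleForm, ← hadef, ← hbdef, ← hgdef]
    field_simp
    ring
  have hvol := T.vol_carrier σ k hkk A (fun i => rfl)
    (by rw [hAdet']; exact neg_ne_zero.2 (by positivity)) (angleForm Λ α β) hq (by
      intro x hx
      have h0 := hx 0
      have h1 := hx 1
      have h2 := hx 2
      simp only [angleForm, chart, Matrix.cons_val, ← hadef, ← hbdef, ← hgdef]
      positivity)
  obtain ⟨h1, h2⟩ := lintegral_angleForm hα hβ hαβ
  rw [hAdet', abs_neg, abs_of_pos (by positivity), h1, ← hγ] at hvol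
  rw [← hγ] at h2
  refine ⟨hvol, h2, ?_⟩
  rw [hdet']
  exact neg_neg_of_pos (by positivity)

/-! ### Angles of arbitrary sign -/

theorem clausenSum_neg (Λ : SignType) (α β γ : ℝ) :
    clausenSum Λ (-β) (-α) (-γ) = -clausenSum Λ α β γ := by
  simp only [clausenSum_eq, logSinInt_neg]; ring

theorem clausenSum_cycle (Λ : SignType) (α β γ : ℝ) :
    clausenSum Λ γ α β = clausenSum Λ α β γ := by
  simp only [clausenSum_eq]; ring

theorem logSinInt_add_int_mul_pi (a : ℝ) (n : ℤ) :
    logSinInt 1 (a + n * Real.pi) = logSinInt 1 a :=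
  (show Function.Periodic (logSinInt 1) Real.pi from logSinInt_add_pi).int_mul n a

/-- The signs `(-1)^m`, `(-1)^n` and `(-1)^(m+n)` cancel in `z`, and `logSinInt` has period `π`. -/
theorem HasDihedralAngles.add_int_mul_pi {y : Fin 4 → Fin 4 → ℝ}
    {B : Matrix (Fin 2) (Fin 2) (GenComplex 1)} {α β γ : ℝ}
    (h : HasDihedralAngles 1 y B α β γ) (m n : ℤ) :
    HasDihedralAngles 1 y B (α + m * Real.pi) (β + n * Real.pi)
      (γ + (-(m + n) : ℤ) * Real.pi) ∧
    clausenSum 1 (α + m * Real.pi) (β + n * Real.pi) (γ + (-(m + n) : ℤ) * Real.pi) =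
      clausenSum 1 α β γ := by
  refine ⟨?_, by simp only [clausenSum_eq, logSinInt_add_int_mul_pi]⟩
  obtain ⟨hsum, hα, hst⟩ := hasDihedralAngles_iff.1 h
  have hm : ((-1 : ℝ) ^ m) ≠ 0 := zpow_ne_zero _ (by norm_num)
  have hn : ((-1 : ℝ) ^ n) ≠ 0 := zpow_ne_zero _ (by norm_num)
  have hm2 : ((-1 : ℝ) ^ m) ^ 2 = 1 := by
    rw [← zpow_natCast, ← zpow_mul, mul_comm, zpow_mul]; norm_num
  have hz : (-1 : ℝ) ^ (-(m + n)) = ((-1) ^ m * (-1) ^ n)⁻¹ := by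
    rw [zpow_neg, zpow_add₀ (by norm_num)]
  refine hasDihedralAngles_iff.2 ⟨by push_cast; linarith, ?_, ?_⟩
  · rw [genSin_one, Real.sin_add_int_mul_pi]
    exact mul_ne_zero hm hα
  · convert hst using 2
    · simp only [genSin_one, genCos_one, Real.sin_add_int_mul_pi, Real.cos_add_int_mul_pi, hz]
      simp only [genSin_one] at hα
      field_simp
      rw [hm2, mul_one]
    · simp only [genSin_one, Real.sin_add_int_mul_pi, hz]
      simp only [genSin_one] at hα
      field_simp
      rw [hm2, mul_one]

theorem exists_add_int_mul_pi_mem_Ioo {a : ℝ} (ha : Real.sin a ≠ 0) :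
    ∃ n : ℤ, 0 < a + n * Real.pi ∧ a + n * Real.pi < Real.pi := by
  have hpi := Real.pi_pos
  refine ⟨-⌊a / Real.pi⌋, ?_, ?_⟩
  · refine lt_of_le_of_ne ?_ fun h => ha ?_
    · have := (le_div_iff₀ hpi).1 (Int.floor_le (a / Real.pi))
      push_cast
      linarith
    · refine Real.sin_eq_zero_iff.2 ⟨⌊a / Real.pi⌋, ?_⟩
      push_cast at h
      linarith
  · have := (div_lt_iff₀ hpi).1 (Int.lt_floor_add_one (a / Real.pi))
    push_cast
    linarith

/-- For `Λ = 1` the angles can be chosen such that `α` and `β` have the same sign. -/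
theorem HasDihedralAngles.exists_reduced {y : Fin 4 → Fin 4 → ℝ} (hy : IsIdealFrame 1 y)
    {B : Matrix (Fin 2) (Fin 2) (GenComplex 1)} {α β γ : ℝ}
    (h : HasDihedralAngles 1 y B α β γ) :
    ∃ α' β' γ' : ℝ, HasDihedralAngles 1 y B α' β' γ' ∧
      clausenSum 1 α' β' γ' = clausenSum 1 α β γ ∧ 0 < α' * β' ∧ |α' + β'| < Real.pi := by
  obtain ⟨hα, hβ, hγ⟩ := h.genSin_ne_zero hy
  obtain ⟨m, hm0, hm1⟩ := exists_add_int_mul_pi_mem_Ioo hα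
  obtain ⟨n, hn0, hn1⟩ := exists_add_int_mul_pi_mem_Ioo hβ
  obtain ⟨h1, e1⟩ := h.add_int_mul_pi m n
  have hne : (α + m * Real.pi) + (β + n * Real.pi) ≠ Real.pi := by
    intro h'
    refine (h1.genSin_ne_zero hy).2.2 ?_
    have : γ + (-(m + n) : ℤ) * Real.pi = -Real.pi := by linarith [h1.1]
    rw [this, genSin_one, Real.sin_neg, Real.sin_pi, neg_zero]
  rcases lt_or_gt_of_ne hne with hlt | hgt
  · exact ⟨_, _, _, h1, e1, mul_pos hm0 hn0, abs_lt.2 ⟨by linarith, hlt⟩⟩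
  -- If the sum exceeds `π`, subtracting `π` from both angles makes both negative, with sum above
  -- `-π`.
  · obtain ⟨h2, e2⟩ := h1.add_int_mul_pi (-1) (-1)
    refine ⟨_, _, _, h2, e2.trans e1, ?_, ?_⟩
    · push_cast
      exact mul_pos_of_neg_of_neg (by linarith) (by linarith)
    · push_cast
      exact abs_lt.2 ⟨by linarith, by linarith⟩

/-- The vertices `y` can be relabelled such that they have angles `α', β' > 0`, and the relabelling
changes the expression `clausenSum Λ α β γ` by its sign. -/
def HasPosRelabelling (Λ : SignType) (y : Fin 4 → Fin 4 → ℝ) (V : ℝ) : Prop :=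
  ∃ (σ : Equiv.Perm (Fin 4)) (B : Matrix (Fin 2) (Fin 2) (GenComplex Λ)) (α β γ : ℝ),
    HasDihedralAngles Λ (y ∘ σ) B α β γ ∧ 0 < α ∧ 0 < β ∧ (Λ = 1 → α + β < Real.pi) ∧
      V = ((Equiv.Perm.sign σ : ℤ) : ℝ) * clausenSum Λ α β γ

theorem HasPosRelabelling.of_comp {y : Fin 4 → Fin 4 → ℝ} {V : ℝ} (τ : Equiv.Perm (Fin 4))
    (h : HasPosRelabelling Λ (y ∘ τ) V) :
    HasPosRelabelling Λ y (((Equiv.Perm.sign τ : ℤ) : ℝ) * V) := by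
  obtain ⟨σ, B, α, β, γ, h1, hα, hβ, hαβ, rfl⟩ := h
  refine ⟨τ * σ, B, α, β, γ, h1, hα, hβ, hαβ, ?_⟩
  rw [Equiv.Perm.sign_mul]
  push_cast
  ring

theorem HasDihedralAngles.hasPosRelabelling_of_mul_pos {y : Fin 4 → Fin 4 → ℝ}
    (hy : IsIdealFrame Λ y) {B : Matrix (Fin 2) (Fin 2) (GenComplex Λ)} {α β γ : ℝ}
    (h : HasDihedralAngles Λ y B α β γ) (hpos : 0 < α * β)
    (hlt : Λ = 1 → |α + β| < Real.pi) : HasPosRelabelling Λ y (clausenSum Λ α β γ) := by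
  rcases pos_and_pos_or_neg_and_neg_of_mul_pos hpos with ⟨hα, hβ⟩ | ⟨hα, hβ⟩
  · exact ⟨1, B, α, β, γ, by simpa using h, hα, hβ, fun h => (abs_lt.1 (hlt h)).2, by simp⟩
  · refine ⟨Equiv.swap 0 1, _, -β, -α, -γ, h.swap (h.genSin_ne_zero hy).2.1, by linarith,
      by linarith, fun h => by linarith [(abs_lt.1 (hlt h)).1], ?_⟩
    rw [clausenSum_neg, Equiv.Perm.sign_swap (by decide)]
    simp

theorem HasDihedralAngles.hasPosRelabelling {y : Fin 4 → Fin 4 → ℝ}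
    (hy : IsIdealFrame Λ y) {B : Matrix (Fin 2) (Fin 2) (GenComplex Λ)} {α β γ : ℝ}
    (h : HasDihedralAngles Λ y B α β γ) : HasPosRelabelling Λ y (clausenSum Λ α β γ) := by
  by_cases hΛ : Λ = 1
  · subst hΛ
    obtain ⟨α', β', γ', h', e, hpos, hlt⟩ := h.exists_reduced hy
    rw [← e]
    exact h'.hasPosRelabelling_of_mul_pos hy hpos fun _ => hlt
  · obtain ⟨hα, hβ, hγ⟩ := h.genSin_ne_zero hy
    set τ : Equiv.Perm (Fin 4) := Equiv.swap 0 1 * Equiv.swap 0 2 with hτ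
    have hsgn : Equiv.Perm.sign τ = 1 := by
      rw [hτ, Equiv.Perm.sign_mul, Equiv.Perm.sign_swap (by decide),
        Equiv.Perm.sign_swap (by decide)]
      rfl
    have h1 := h.cycle hγ
    have h2 := h1.cycle hβ
    rw [← hτ] at h1 h2
    have e (y : Fin 4 → Fin 4 → ℝ) (V : ℝ) (h : HasPosRelabelling Λ (y ∘ τ) V) :
        HasPosRelabelling Λ y V := by simpa [hsgn] using h.of_comp τ
    rw [Ne, genSin_eq_zero_iff hΛ] at hα hβ hγ
    -- Of three nonzero reals two have the same sign, and an even relabelling moves them to the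
    -- first two places.
    by_cases hab : 0 < α * β
    · exact h.hasPosRelabelling_of_mul_pos hy hab fun h => absurd h hΛ
    by_cases hca : 0 < γ * α
    · rw [← clausenSum_cycle]
      exact e _ _ (h1.hasPosRelabelling_of_mul_pos (hy.comp τ) hca fun h => absurd h hΛ)
    have hbc : 0 < β * γ := by
      have h3 : α * β < 0 := lt_of_le_of_ne (not_lt.1 hab) (mul_ne_zero hα hβ)
      have h4 : γ * α < 0 := lt_of_le_of_ne (not_lt.1 hca) (mul_ne_zero hγ hα)
      have h5 := mul_pos_of_neg_of_neg h3 h4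
      have h6 : α * β * (γ * α) = α ^ 2 * (β * γ) := by ring
      rw [h6] at h5
      exact (pos_iff_pos_of_mul_pos h5).1 (by positivity)
    rw [← clausenSum_cycle, ← clausenSum_cycle]
    exact e _ _ (e _ _
      (h2.hasPosRelabelling_of_mul_pos ((hy.comp τ).comp τ) hbc fun h => absurd h hΛ))

end VolumeFormula

end GenIdeal

end

/-! ### Assembly of the theorem -/

theorem mainTheorem1 (Λ : SignType) (T : GenIdeal.IdealTetrahedron Λ) :
    -- generalized dihedral angles exist, with the usual range for `Λ = 1`
    (∃ (B : Matrix (Fin 2) (Fin 2) (GenIdeal.GenComplex Λ)) (α β γ : ℝ),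
      GenIdeal.HasDihedralAngles Λ T.lift B α β γ ∧
      (Λ = 1 → (0 < |α| ∧ |α| < Real.pi) ∧ (0 < |β| ∧ |β| < Real.pi) ∧
        (0 < |γ| ∧ |γ| < Real.pi))) ∧
    -- after relabelling the vertices, `α` and `β` are positive
    (∃ (σ : Equiv.Perm (Fin 4)) (B : Matrix (Fin 2) (Fin 2) (GenIdeal.GenComplex Λ))
      (α β γ : ℝ), GenIdeal.HasDihedralAngles Λ (T.lift ∘ σ) B α β γ ∧
      0 < α ∧ 0 < β ∧ (Λ = 1 → α + β < Real.pi)) ∧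
    -- the volume is finite
    GenIdeal.vol Λ T.carrier ≠ ⊤ ∧
    -- volume formula for positive `α` and `β`, for any labelling of the vertices
    (∀ (σ : Equiv.Perm (Fin 4)) (B : Matrix (Fin 2) (Fin 2) (GenIdeal.GenComplex Λ))
      (α β γ : ℝ), GenIdeal.HasDihedralAngles Λ (T.lift ∘ σ) B α β γ →
      0 < α → 0 < β → (Λ = 1 → α + β < Real.pi) →
      (GenIdeal.vol Λ T.carrier).toReal =
        1 / 2 * (GenIdeal.genClausen Λ (2 * α) + GenIdeal.genClausen Λ (2 * β)
          + GenIdeal.genClausen Λ (2 * γ))) ∧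
    -- volume formula for dihedral angles of any sign, with the oriented volume
    (∀ (B : Matrix (Fin 2) (Fin 2) (GenIdeal.GenComplex Λ)) (α β γ : ℝ),
      GenIdeal.HasDihedralAngles Λ T.lift B α β γ →
      (T.orientation : ℝ) * (GenIdeal.vol Λ T.carrier).toReal =
        1 / 2 * (GenIdeal.genClausen Λ (2 * α) + GenIdeal.genClausen Λ (2 * β)
          + GenIdeal.genClausen Λ (2 * γ))) := by
  have hfr := T.isIdealFrame
  obtain ⟨B, α, β, γ, h⟩ := hfr.exists_angles
  obtain ⟨σ, B', α', β', γ', h', hα', hβ', hαβ', -⟩ := h.hasPosRelabelling hfr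
  refine ⟨?_, ⟨σ, B', α', β', γ', h', hα', hβ', hαβ'⟩, ?_, ?_, ?_⟩
  · by_cases hΛ : Λ = 1
    · subst hΛ
      obtain ⟨a, b, c, h1, -, hab, hlt⟩ := h.exists_reduced hfr
      have hsum : a + b + c = 0 := h1.1
      have hc : c = -(a + b) := by linarith
      refine ⟨B, a, b, c, h1, fun _ => ?_⟩
      rw [hc, abs_neg]
      rw [abs_lt] at hlt
      rcases pos_and_pos_or_neg_and_neg_of_mul_pos hab with ⟨ha, hb⟩ | ⟨ha, hb⟩
      · rw [abs_of_pos ha, abs_of_pos hb, abs_of_pos (add_pos ha hb)]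
        exact ⟨⟨ha, by linarith⟩, ⟨hb, by linarith⟩, by linarith, hlt.2⟩
      · rw [abs_of_neg ha, abs_of_neg hb, abs_of_neg (add_neg ha hb)]
        exact ⟨⟨by linarith, by linarith⟩, ⟨by linarith, by linarith⟩, by linarith, by linarith⟩
    · exact ⟨B, α, β, γ, h, fun h => absurd h hΛ⟩
  · rw [(T.vol_of_pos_angles σ h' hα' hβ' hαβ').1]
    exact ENNReal.ofReal_ne_top
  · intro τ C a b c h1 ha hb hab
    obtain ⟨h2, h3, -⟩ := T.vol_of_pos_angles τ h1 ha hb hab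
    rw [h2, ENNReal.toReal_ofReal h3]
    rfl
  · intro C a b c h1
    obtain ⟨τ, C', a', b', c', h2, ha, hb, hab, hV⟩ := h1.hasPosRelabelling hfr
    obtain ⟨h3, h4, h5⟩ := T.vol_of_pos_angles τ h2 ha hb hab
    have hdet : (Matrix.of (T.lift ∘ τ)).det =
        ((Equiv.Perm.sign τ : ℤ) : ℝ) * (Matrix.of T.lift).det := Matrix.det_permute τ _
    change _ = GenIdeal.clausenSum Λ a b c
    rw [h3, ENNReal.toReal_ofReal h4, hV]
    congr 1
    -- After relabelling the determinant is negative, so the orientation equals the sign of the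
    -- permutation.
    rw [hdet] at h5
    unfold GenIdeal.IdealTetrahedron.orientation
    rcases Int.units_eq_one_or (Equiv.Perm.sign τ) with hs | hs <;> rw [hs] at h5 ⊢
    · rw [sign_pos (by simpa using h5)]
      simp
    · rw [sign_neg (by simpa using h5)]
      simp
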